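/- **The Dynamic Calculus for EAK.** Fix sets $\mathsf{AtProp}$ (atomic propositions), $\mathsf{Fnc}$ (functional actions) and $\mathsf{Ag}$ (agents). There are four types $\mathsf{Ag},\mathsf{Fnc},\mathsf{Act},\mathsf{Fm}$. *Heterogeneous connectives.* For $0\le i\le 3$ let $\mathsf{T}_i$ be the type $\mathsf{Fnc},\mathsf{Act},\mathsf{Ag},\mathsf{Ag}$ respectively; $\vartriangle_i,\blacktriangle_i$ have the functionality $\mathsf{T}_i\times\mathsf{Fm}\to\mathsf{Fm}$ for $i\le 2$, and $\mathsf{Ag}\times\mathsf{Fnc}\to\mathsf{Act}$ for $i=3$. *Operational terms.* Atoms: $p\in\mathsf{AtProp}$, $\bot$, $\top$ (type $\mathsf{Fm}$), $\alpha\in\mathsf{Fnc}$, $\mathtt a\in\mathsf{Ag}$. Compound terms: $A\wedge B$, $A\vee B$, $A\to B$, $B\leftarrow A$, $A \mathbin{{>}\!\!-} B$, $B\mathbin{-\!\!{<}}A$ for formulas $A,B$; $a\vartriangle_i b$ and $a\blacktriangle_i b$ ($0\le i\le 3$), of the types above; and $a\,{-\!\vartriangleright_i}\,B$, $a\,{-\!\blacktriangleright_i}\,B$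 ($0\le i\le 2$, $a$ of type $\mathsf{T}_i$, $B$ and the result of type $\mathsf{Fm}$). *Structures* are generated, typewise, from operational terms and the constant $\mathrm I$ of type $\mathsf{Fm}$ by: $X;Y$, $X>Y$, $X<Y$ (type $\mathsf{Fm}$); and, for $0\le i\le 3$, where $\vartriangle_i,\blacktriangle_i$ map $S\times T$ to $U$ as above: $x\vartriangle_i y$, $x\blacktriangle_i y$ (type $U$); $x\vartriangleright_i z$, $x\blacktriangleright_i z$ (type $T$) and $z\vartriangleleft_i y$, $z\blacktriangleleft_i y$ (type $S$), for $x,y,z$ of types $S,T,U$ (those of the last two kinds that have no operational counterpart are the virtual adjoints $\sim$). The first coordinate of $>,\vartriangleright_i,\blacktriangleright_i$ and the second one of $<,\vartriangleleft_i,\blacktriangleleft_i$ are antitone, all other coordinates monotone; this determines which occurrences in a sequent $x\vdash y$ are in precedent and which in succedent position. A *sequent* $x\vdash y$ is a pair of structures, possibly of different types; it is *type-uniform* if $x$ and $y$ have the same type. *Rules.* Below, $(\circ,\rhd,\lhd,\rhd',\lhd')$ is $(\vartriangle_i,\vartriangleright_i,\vartriangleleft_i,\blacktriangleright_i,\blacktriangleleft_i)$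 or $(\blacktriangle_i,\blacktriangleright_i,\blacktriangleleft_i,\vartriangleright_i,\vartriangleleft_i)$ for any $i\le 2$ (any $i\le3$ where indicated), and $\circ'$ is the triangle of the other colour; $-\!\rhd$ is the operational arrow corresponding to $\rhd$. Letters $x,y,z,X,Y,Z,W,F,\mathtt x$ stand for arbitrary structures of fitting types ($F$ of type $\mathsf{Fnc}$, $\mathtt x$ of type $\mathsf{Ag}$, $X,Y,Z,W$ of type $\mathsf{Fm}$), and $a,b,A,B$ for operational terms. "$\Leftrightarrow$" means a rule in each direction. - Display postulates: $X;Y\vdash Z\Leftrightarrow X\vdash Z<Y$; $\;Z\vdash X;Y\Leftrightarrow Z<Y\vdash X$; $\;X;Y\vdash Z\Leftrightarrow Y\vdash X>Z$; $\;Z\vdash X;Y\Leftrightarrow X>Z\vdash Y$; $\;x\circ y\vdash z\Leftrightarrow y\vdash x\rhd' z$; $\;x\circ y\vdash z\Leftrightarrow x\vdash z\lhd' y$ (all $i\le 3$). - Axioms: $\mathtt a\vdash\mathtt a$; $\alpha\vdash\alpha$; $p\vdash p$; $\bot\vdash\mathrm I$; $\mathrm I\vdash\top$; and *atom*: $F_1\circ_1(F_2\circ_2\cdots(F_n\circ_n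 p))\vdash G_1\rhd_1(\cdots(G_m\rhd_m p))$ with $n,m\ge0$, $\circ_j\in\{\vartriangle_0,\blacktriangle_0\}$, $\rhd_j\in\{\vartriangleright_0,\blacktriangleright_0\}$, $F_j,G_j$ structures of type $\mathsf{Fnc}$. - Cut, for each type: from $x\vdash a$ and $a\vdash y$ infer $x\vdash y$, where $x,a,y$ have the same type. - Structural rules (premise $/$ conclusion): $X\vdash Y\Leftrightarrow\mathrm I\vdash Y<X$; $X\vdash Y\Leftrightarrow X<Y\vdash\mathrm I$; $X\vdash Y\Leftrightarrow\mathrm I\vdash X>Y$; $X\vdash Y\Leftrightarrow Y>X\vdash\mathrm I$; $\mathrm I\vdash Y/X\vdash Y$; $X\vdash\mathrm I/X\vdash Y$; weakening $X\vdash Y/Z\vdash Y<X$, $X\vdash Y/X<Y\vdash Z$, $X\vdash Y/Z\vdash X>Y$, $X\vdash Y/Y>X\vdash Z$; contraction $X;X\vdash Y/X\vdash Y$ and $Y\vdash X;X/Y\vdash X$; exchange $Y;X\vdash Z/X;Y\vdash Z$ and $Z\vdash X;Y/Z\vdash Y;X$; associativity $X;(Y;Z)\vdash W/(X;Y);Z\vdash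 W$ and $W\vdash(Z;Y);X/W\vdash Z;(Y;X)$; and, in the version on a classical base only, the Grishin rules $X>(Y;Z)\vdash W\Leftrightarrow(X>Y);Z\vdash W$ and $W\vdash X>(Y;Z)\Leftrightarrow W\vdash(X>Y);Z$. - For $i\le2$, $x$ of type $\mathsf T_i$: necessitation $\mathrm I\vdash W/x\circ\mathrm I\vdash W$, $W\vdash\mathrm I/W\vdash x\rhd\mathrm I$; conjugation $x\circ((x\circ' Y);Z)\vdash W/Y;(x\circ Z)\vdash W$, $W\vdash x\rhd((x\rhd' Y);Z)/W\vdash Y;(x\rhd Z)$; Fischer Servi $(x\rhd Y)>(x\circ Z)\vdash W/x\circ(Y>Z)\vdash W$, $W\vdash(x\circ Y)>(x\rhd Z)/W\vdash x\rhd(Y>Z)$; monotonicity $(x\circ Y);(x\circ Z)\vdash W/x\circ(Y;Z)\vdash W$, $W\vdash(x\rhd Y);(x\rhd Z)/W\vdash x\rhd(Y;Z)$. - Swap-out: $(\mathtt x\blacktriangle_3F)\blacktriangle_1(\mathtt x\blacktriangle_2X)\vdash Y/\mathtt x\blacktriangle_2(F\blacktriangle_0X)\vdash Y$ and $X\vdash(\mathtt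 x\blacktriangle_3F)\blacktriangleright_1(\mathtt x\blacktriangleright_2Y)/X\vdash\mathtt x\blacktriangleright_2(F\blacktriangleright_0Y)$. Swap-in: $\mathtt x\blacktriangle_2(F\blacktriangle_0X)\vdash Y/(\mathtt x\blacktriangle_3F)\blacktriangle_1(\mathtt x\blacktriangle_2((F\vartriangle_0\mathrm I);X))\vdash Y$ and $X\vdash\mathtt x\blacktriangleright_2(F\blacktriangleright_0Y)/X\vdash(\mathtt x\blacktriangle_3F)\blacktriangleright_1(\mathtt x\blacktriangleright_2((F\vartriangle_0\mathrm I)>Y))$. Balance: $X\vdash Y/F\vartriangle_0X\vdash F\vartriangleright_0Y$. - Operational rules: $X\vdash\mathrm I/X\vdash\bot$; $\mathrm I\vdash X/\top\vdash X$; $A;B\vdash Z/A\wedge B\vdash Z$; $X\vdash A,\;Y\vdash B/X;Y\vdash A\wedge B$; $A\vdash X,\;B\vdash Y/A\vee B\vdash X;Y$; $Z\vdash A;B/Z\vdash A\vee B$; $B\vdash Y,\;X\vdash A/B\leftarrow A\vdash Y<X$; $Z\vdash B<A/Z\vdash B\leftarrow A$; $B<A\vdash Z/B\mathbin{-\!\!{<}}A\vdash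 Z$; $Y\vdash B,\;A\vdash X/Y<X\vdash B\mathbin{-\!\!{<}}A$; $X\vdash A,\;B\vdash Y/A\to B\vdash X>Y$; $Z\vdash A>B/Z\vdash A\to B$; $A>B\vdash Z/A\mathbin{{>}\!\!-}B\vdash Z$; $A\vdash X,\;Y\vdash B/X>Y\vdash A\mathbin{{>}\!\!-}B$; for $i\le3$: $a\circ b\vdash z/a\circ b\vdash z$ (structural in the premise, operational in the conclusion), $x\vdash a,\;y\vdash b/x\circ y\vdash a\circ b$ (structural $\circ$ on the left, operational on the right); for $i\le2$: $x\vdash a,\;B\vdash Y/a\,{-\!\rhd}\,B\vdash x\rhd Y$, and $Z\vdash a\rhd B/Z\vdash a\,{-\!\rhd}\,B$. **Quasi-properly displayable multi-type calculi.** In an application of a rule, the *parameters* are the structures substituted for the structure letters of the rule, and all constituents of these; two of them are *congruent* if they are corresponding constituents of the structures standing for the same letter. An operational term is *principal* if the rule displays it (as a term, not inside a structure letter) in its conclusion. Cuts of type $T$ are *trivial* if whenever $x\vdash a$ and $a\vdash y$ are derivable with $x,a,y$ of type $T$, then $x=a$ or $y=a$. A connective occurrence is *severe* if it is some $\vartriangle_i,\blacktriangle_i$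 in succedent position or some $\vartriangleright_i,\blacktriangleright_i,\vartriangleleft_i,\blacktriangleleft_i$ in precedent position. *Axioms* are the instances of rules without premises; two sequents are *display-equivalent* if each comes from the other by display postulates. The calculus is *quasi-properly displayable* if: - (Display) every substructure of a derivable sequent which is not in the scope of a severe connective is the whole precedent or the whole succedent, according to its position, of some display-equivalent sequent. - ($\mathrm C_1$) In every rule other than cut, each operational term occurring (as an atomic structure) in a premise is a subterm of an operational term occurring in the conclusion. - ($\mathrm C_2$), ($\mathrm C'_2$) Congruent parameters are occurrences of the same structure, and have the same type. - ($\mathrm C'_3$) Each parameter is congruent to at most one constituent of the conclusion; this is not required of structures substituted for letters of a type all cuts of which are trivial, and of the constituents of these structures. - ($\mathrm C_4$) Congruent parameters are all in precedent or all in succedent position. - ($\mathrm C'_5$) A principal operational term of a rule is the whole precedent or succedent of the conclusion, unless the rule is an axiom. - ($\mathrm C''_5$) If a display postulate takes an axiom of some type to a sequent of the same type, the result is an axiom; and every principal term of an axiom is the whole precedent or succedent (according to its position) of some display-equivalent axiom. - ($\mathrm C'_6$), ($\mathrm C'_7$) For a parametric operational term $a$ in succedent (respectively precedent) position in a rule application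 and any structure $z$ of the same type, simultaneous replacement of this occurrence and all those congruent to it by $z$ gives an application of the same rule. - ($\mathrm C'_8$) If $x\vdash a$ and $a\vdash y$, with $a$ principal in both, are conclusions of applications of rules other than cut, then $x\vdash y$ is derivable from the premises of these two applications by the rules of the calculus, using only cuts (strongly type-uniform) on proper subterms of $a$. - ($\mathrm C''_8$) If $x\vdash a$ and $a\vdash y$ are axioms, then so is $x\vdash y$. - ($\mathrm C_9$) Every derivable sequent is type-uniform. - ($\mathrm C_{10}$) In each application of a cut rule the premises and the conclusion are type-uniform of one and the same type. **Theorem.** Let $\mathsf{AtProp},\mathsf{Fnc},\mathsf{Ag}$ be arbitrary sets, and consider the Dynamic Calculus for EAK over them, on the intuitionistic or on the classical base. 1. It is a quasi-properly displayable multi-type calculus; in particular all the conditions above, among them non-proliferation $\mathrm C'_3$ and $\mathrm C'_8$, hold. 2. Every derivable sequent is type-uniform. 3. If $x\vdash a$ is derivable, where $a$ is an operational term and $x$ a structure, both of type $\mathsf{Ag}$ or both of type $\mathsf{Fnc}$, then $x=a$; so all cuts of types $\mathsf{Ag}$ and $\mathsf{Fnc}$ are trivial. 4. (Cut elimination) Every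 derivable sequent has a derivation without cut. 5. (Subformula property) Every derivable sequent $s$ has a cut-free derivation in which every operational term that occurs is a subterm of an operational term occurring in $s$. -/

import Mathlib

universe u

namespace DynCalc

/-! ### Types, connectives, operational terms -/

/-- The four types: agents, functional actions, actions, formulas. -/
inductive Ty : Type
  | ag | fnc | act | fm

/-- White (`△`, `▷`, `◁`) and black (`▲`, `▶`, `◀`) versions of the heterogeneous connectives. -/
inductive Shade : Type
  | white | black

def Shade.flip : Shade → Shade
  | .white => .black
  | .black => .white

/-- The indices `0, 1, 2, 3` of the heterogeneous connectives with their types: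
`Fam A B C` means `△ᵢ, ▲ᵢ : A × B → C`.  Hence `Fam A fm fm` are the indices `0 ≤ i ≤ 2`. -/
inductive Fam : Ty → Ty → Ty → Type
  | i0 : Fam .fnc .fm .fm
  | i1 : Fam .act .fm .fm
  | i2 : Fam .ag .fm .fm
  | i3 : Fam .ag .fnc .act

/-- Binary operational connectives: `∧, ∨, →, ←`, the two subtractions `>-` (`excl`) and
`-<` (`lexcl`), `△ᵢ, ▲ᵢ` for `0 ≤ i ≤ 3`, and `-▷ᵢ, -▶ᵢ` for `0 ≤ i ≤ 2`. -/
inductive OpConn : Ty → Ty → Ty → Type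
  | and : OpConn .fm .fm .fm
  | or : OpConn .fm .fm .fm
  | imp : OpConn .fm .fm .fm
  | limp : OpConn .fm .fm .fm
  | excl : OpConn .fm .fm .fm
  | lexcl : OpConn .fm .fm .fm
  | tri {A B C : Ty} (s : Shade) (i : Fam A B C) : OpConn A B C
  | arr {A : Ty} (s : Shade) (i : Fam A .fm .fm) : OpConn A .fm .fm

/-- Operational terms over atomic propositions `P`, functional actions `F` and agents `A`. -/
inductive Term (P F A : Type u) : Ty → Type u
  | prop (p : P) : Term P F A .fm
  | fnc (f : F) : Term P F A .fnc
  | agt (a : A) : Term P F A .ag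
  | bot : Term P F A .fm
  | top : Term P F A .fm
  | node {T₁ T₂ T : Ty} (c : OpConn T₁ T₂ T) (a : Term P F A T₁) (b : Term P F A T₂) :
      Term P F A T

/-- `Subterm a b`: the operational term `a` is a (not necessarily proper) subterm of `b`. -/
inductive Subterm {P F A : Type u} : {S T : Ty} → Term P F A S → Term P F A T → Prop
  | refl {T : Ty} (a : Term P F A T) : Subterm a a
  | left {S T₁ T₂ T : Ty} {a : Term P F A S} (c : OpConn T₁ T₂ T) {b : Term P F A T₁}
      (d : Term P F A T₂) : Subterm a b → Subterm a (Term.node c b d)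
  | right {S T₁ T₂ T : Ty} {a : Term P F A S} (c : OpConn T₁ T₂ T) (b : Term P F A T₁)
      {d : Term P F A T₂} : Subterm a d → Subterm a (Term.node c b d)

inductive ProperSubterm {P F A : Type u} : {S T : Ty} → Term P F A S → Term P F A T → Prop
  | left {S T₁ T₂ T : Ty} {a : Term P F A S} (c : OpConn T₁ T₂ T) {b : Term P F A T₁}
      (d : Term P F A T₂) : Subterm a b → ProperSubterm a (Term.node c b d)
  | right {S T₁ T₂ T : Ty} {a : Term P F A S} (c : OpConn T₁ T₂ T) (b : Term P F A T₁)
      {d : Term P F A T₂} : Subterm a d → ProperSubterm a (Term.node c b d)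

/-! ### Structures and sequents -/

/-- Binary structural connectives: `;`, `>`, `<`, the triangles `tri s i`, their residuals in the
second coordinate `arr s i` (`▷ᵢ, ▶ᵢ`; for `i = 3` virtual adjoints) and in the first coordinate
`lar s i` (`◁ᵢ, ◀ᵢ`; for `i = 0, 2, 3` virtual adjoints). -/
inductive Conn : Ty → Ty → Ty → Type
  | semi : Conn .fm .fm .fm
  | gt : Conn .fm .fm .fm
  | lt : Conn .fm .fm .fm
  | tri {A B C : Ty} (s : Shade) (i : Fam A B C) : Conn A B C
  | arr {A B C : Ty} (s : Shade) (i : Fam A B C) : Conn A C B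
  | lar {A B C : Ty} (s : Shade) (i : Fam A B C) : Conn C B A

/-- Is the first coordinate negative (antitone)? -/
def Conn.neg₁ {T₁ T₂ T : Ty} : Conn T₁ T₂ T → Bool
  | .semi => false
  | .gt => true
  | .lt => false
  | .tri _ _ => false
  | .arr _ _ => true
  | .lar _ _ => false

/-- Is the second coordinate negative (antitone)? -/
def Conn.neg₂ {T₁ T₂ T : Ty} : Conn T₁ T₂ T → Bool
  | .semi => false
  | .gt => false
  | .lt => true
  | .tri _ _ => false
  | .arr _ _ => false
  | .lar _ _ => true

/-- An occurrence of a connective is severe if no display postulate applies to it: triangles in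
succedent position and arrows in precedent position (`ant` says whether it is in precedent
position). -/
def Conn.Severe {T₁ T₂ T : Ty} (ant : Bool) : Conn T₁ T₂ T → Prop
  | .semi => False
  | .gt => False
  | .lt => False
  | .tri _ _ => ant = false
  | .arr _ _ => ant = true
  | .lar _ _ => ant = true

/-- Structures with leaves `L`: actual structures have operational terms as leaves, structure
schemas also have structure variables as leaves. -/
inductive Str (L : Ty → Type u) : Ty → Type u
  | leaf {T : Ty} (a : L T) : Str L T
  | unit : Str L .fm
  | node {T₁ T₂ T : Ty} (c : Conn T₁ T₂ T) (x : Str L T₁) (y : Str L T₂) : Str L T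

/-- A sequent `l ⊢ r`; the two sides may have different types. -/
structure Seq (L : Ty → Type u) where
  {lt : Ty}
  {rt : Ty}
  l : Str L lt
  r : Str L rt

infix:25 " ⊢ₛ " => Seq.mk
infixl:65 " ⨾ " => Str.node Conn.semi
infixr:60 " ≻ " => Str.node Conn.gt
infixl:60 " ≺ " => Str.node Conn.lt

abbrev tri {L : Ty → Type u} {A B C : Ty} (s : Shade) (i : Fam A B C)
    (x : Str L A) (y : Str L B) : Str L C := .node (.tri s i) x y

abbrev arr {L : Ty → Type u} {A B C : Ty} (s : Shade) (i : Fam A B C)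
    (x : Str L A) (z : Str L C) : Str L B := .node (.arr s i) x z

abbrev lar {L : Ty → Type u} {A B C : Ty} (s : Shade) (i : Fam A B C)
    (z : Str L C) (y : Str L B) : Str L A := .node (.lar s i) z y

/-- The sequent is type-uniform, of type `T`. -/
def Seq.OfType {L : Ty → Type u} (s : Seq L) (T : Ty) : Prop := s.lt = T ∧ s.rt = T

def Seq.TypeUniform {L : Ty → Type u} (s : Seq L) : Prop := ∃ T, s.OfType T

/-! ### Occurrences and their positions -/

inductive Side : Type
  | left | right

/-- The substructure at a path of the generation tree, if there is one. -/
def Str.subAt {L : Ty → Type u} : {T : Ty} → Str L T → List Side → Option (Σ S : Ty, Str L S)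
  | T, x, [] => some ⟨T, x⟩
  | _, .node _ x _, .left :: p => x.subAt p
  | _, .node _ _ y, .right :: p => y.subAt p
  | _, .leaf _, _ :: _ => none
  | _, .unit, _ :: _ => none

/-- Does the path go through an odd number of negative coordinates? -/
def Str.negAt {L : Ty → Type u} : {T : Ty} → Str L T → List Side → Bool
  | _, .node c x _, .left :: p => xor c.neg₁ (x.negAt p)
  | _, .node c _ y, .right :: p => xor c.neg₂ (y.negAt p)
  | _, _, _ => false

/-- No severe connective occurs strictly above the given path, in a structure that is itself in
precedent (`ant = true`) or succedent (`ant = false`) position. -/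
def Str.ClearAt {L : Ty → Type u} : {T : Ty} → (ant : Bool) → Str L T → List Side → Prop
  | _, ant, .node c x _, .left :: p => ¬ c.Severe ant ∧ x.ClearAt (xor ant c.neg₁) p
  | _, ant, .node c _ y, .right :: p => ¬ c.Severe ant ∧ y.ClearAt (xor ant c.neg₂) p
  | _, _, _, _ => True

def Seq.subAt {L : Ty → Type u} (s : Seq L) : Side → List Side → Option (Σ S : Ty, Str L S)
  | .left, p => s.l.subAt p
  | .right, p => s.r.subAt p

/-- Is this occurrence in precedent (antecedent) position? -/
def Seq.antAt {L : Ty → Type u} (s : Seq L) : Side → List Side → Bool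
  | .left, p => !(s.l.negAt p)
  | .right, p => s.r.negAt p

def Seq.ClearAt {L : Ty → Type u} (s : Seq L) : Side → List Side → Prop
  | .left, p => s.l.ClearAt true p
  | .right, p => s.r.ClearAt false p

/-- The structure `z` is in display in `s`, in precedent (`ant = true`) or in succedent
(`ant = false`) position. -/
def Seq.Displays {L : Ty → Type u} (s : Seq L) (ant : Bool) (z : Σ S : Ty, Str L S) : Prop :=
  if ant = true then (⟨s.lt, s.l⟩ : Σ S : Ty, Str L S) = z
  else (⟨s.rt, s.r⟩ : Σ S : Ty, Str L S) = z

open Classical in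
/-- Replace by `z` all operational terms of the type of `z` that occur at a path in `Q`. -/
noncomputable def Str.replace {L : Ty → Type u} {S : Ty} (z : Str L S) :
    {T : Ty} → Str L T → Set (List Side) → Str L T
  | T, .leaf a, Q => if h : S = T ∧ [] ∈ Q then h.1 ▸ z else .leaf a
  | _, .unit, _ => .unit
  | _, .node c x y, Q =>
      .node c (Str.replace z x {p | Side.left :: p ∈ Q}) (Str.replace z y {p | Side.right :: p ∈ Q})

noncomputable def Seq.replace {L : Ty → Type u} {S : Ty} (z : Str L S) (s : Seq L)
    (Q : Set (Side × List Side)) : Seq L :=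
  Str.replace z s.l {p | (Side.left, p) ∈ Q} ⊢ₛ Str.replace z s.r {p | (Side.right, p) ∈ Q}

/-- The operational term `a` occurs in `s` (as a leaf of the generation tree of a side). -/
def Seq.HasTerm {P F A : Type u} (s : Seq (Term P F A)) {T : Ty} (a : Term P F A T) : Prop :=
  ∃ d p, s.subAt d p = some ⟨T, .leaf a⟩

/-! ### Rule schemas, instances, derivations -/

/-- Leaves of structure schemas: structure variables (the parameters of a rule) and operational
terms (which are not parametric). -/
inductive Sch (P F A : Type u) : Ty → Type u
  | var {T : Ty} (n : ℕ) : Sch P F A T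
  | term {T : Ty} (a : Term P F A T) : Sch P F A T

/-- The structure variable number `n` (of the type required by the context). -/
abbrev v {P F A : Type u} {T : Ty} (n : ℕ) : Str (Sch P F A) T := .leaf (.var n)

/-- The formula-type structure variable number `n`. -/
abbrev X {P F A : Type u} (n : ℕ) : Str (Sch P F A) .fm := v n

/-- An operational term as a structure schema. -/
abbrev o {P F A : Type u} {T : Ty} (a : Term P F A T) : Str (Sch P F A) T := .leaf (.term a)

/-- Assignments of structures to structure variables. -/
abbrev Asg (P F A : Type u) : Type u := (T : Ty) → ℕ → Str (Term P F A) T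

def Str.inst {P F A : Type u} (σ : Asg P F A) :
    {T : Ty} → Str (Sch P F A) T → Str (Term P F A) T
  | T, .leaf (.var n) => σ T n
  | _, .leaf (.term a) => .leaf a
  | _, .unit => .unit
  | _, .node c x y => .node c (x.inst σ) (y.inst σ)

def Seq.inst {P F A : Type u} (σ : Asg P F A) (s : Seq (Sch P F A)) : Seq (Term P F A) :=
  s.l.inst σ ⊢ₛ s.r.inst σ

/-- A rule schema; its applications are its instances under assignments. -/
structure Rule (P F A : Type u) where
  prems : List (Seq (Sch P F A))
  concl : Seq (Sch P F A)

/-- `Derives R K H s`: the sequent `s` has a derivation from hypotheses in `H` by applications of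
rules in `R` in which all sequents belong to `K`. -/
inductive Derives {P F A : Type u} (R : Set (Rule P F A)) (K H : Set (Seq (Term P F A))) :
    Seq (Term P F A) → Prop
  | hyp {s : Seq (Term P F A)} : s ∈ H → s ∈ K → Derives R K H s
  | app {r : Rule P F A} (σ : Asg P F A) : r ∈ R → r.concl.inst σ ∈ K →
      (∀ q ∈ r.prems, Derives R K H (q.inst σ)) → Derives R K H (r.concl.inst σ)

/-- The cut rule with cut term `a`: from `x ⊢ a` and `a ⊢ y` infer `x ⊢ y`. -/
def cutRule {P F A : Type u} {T : Ty} (a : Term P F A T) : Rule P F A :=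
  ⟨[(v 0 : Str _ T) ⊢ₛ o a, o a ⊢ₛ (v 1 : Str _ T)], (v 0 : Str _ T) ⊢ₛ (v 1 : Str _ T)⟩

def cutRules (P F A : Type u) : Set (Rule P F A) :=
  {r | ∃ (T : Ty) (a : Term P F A T), r = cutRule a}

/-- A multi-type calculus in this language: its rules other than cut, and those among them that
are display postulates.  It is understood to have in addition the cut rules of each type. -/
structure Calculus (P F A : Type u) where
  rules : Set (Rule P F A)
  display : Set (Rule P F A)
  display_subset : display ⊆ rules

namespace Calculus

variable {P F A : Type u} (C : Calculus P F A)

def allRules : Set (Rule P F A) := C.rules ∪ cutRules P F A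

def Derivable (s : Seq (Term P F A)) : Prop := Derives C.allRules Set.univ ∅ s

def CutFreeDerivable (s : Seq (Term P F A)) : Prop := Derives C.rules Set.univ ∅ s

/-- Axioms are instances of rules without premises. -/
def IsAxiom (s : Seq (Term P F A)) : Prop :=
  ∃ r ∈ C.rules, ∃ σ, r.prems = [] ∧ s = r.concl.inst σ

/-- `t` results from `s` by one application of a display postulate. -/
def DisplayStep (s t : Seq (Term P F A)) : Prop :=
  ∃ r ∈ C.display, ∃ σ, r.prems.map (Seq.inst σ) = [s] ∧ r.concl.inst σ = t

def DisplayEquiv (s t : Seq (Term P F A)) : Prop :=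
  Relation.ReflTransGen C.DisplayStep s t ∧ Relation.ReflTransGen C.DisplayStep t s

end Calculus

/-! ### Parameters and congruence -/

/-- The sequent schema of a rule with index `i`: the conclusion (`none`) or a premise. -/
def Rule.seqAt {P F A : Type u} (r : Rule P F A) : Option (Fin r.prems.length) → Seq (Sch P F A)
  | none => r.concl
  | some k => r.prems.get k

/-- The location of a (possible) occurrence in an application of the rule `r`. -/
structure Loc {P F A : Type u} (r : Rule P F A) where
  idx : Option (Fin r.prems.length)
  side : Side
  path : List Side

/-- In the instance of `r` under `σ`, the occurrence at `ℓ` is a parameter, namely the constituent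
at the inner path `q` of an occurrence of the structure variable `n` of type `T`. -/
def IsParam {P F A : Type u} (r : Rule P F A) (σ : Asg P F A) (T : Ty) (n : ℕ) (q : List Side)
    (ℓ : Loc r) : Prop :=
  ((σ T n).subAt q).isSome = true ∧
    ∃ p, ℓ.path = p ++ q ∧ (r.seqAt ℓ.idx).subAt ℓ.side p = some ⟨T, .leaf (.var n)⟩

/-- Congruence of parameters: corresponding constituents of occurrences of the same variable. -/
def Congruent {P F A : Type u} (r : Rule P F A) (σ : Asg P F A) (ℓ ℓ' : Loc r) : Prop :=
  ∃ T n q, IsParam r σ T n q ℓ ∧ IsParam r σ T n q ℓ'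

/-- What occurs at `ℓ` in the instance of `r` under `σ`. -/
def Loc.val {P F A : Type u} {r : Rule P F A} (ℓ : Loc r) (σ : Asg P F A) :
    Option (Σ S : Ty, Str (Term P F A) S) :=
  ((r.seqAt ℓ.idx).inst σ).subAt ℓ.side ℓ.path

/-- Is `ℓ` in precedent position in the instance of `r` under `σ`? -/
def Loc.ant {P F A : Type u} {r : Rule P F A} (ℓ : Loc r) (σ : Asg P F A) : Bool :=
  ((r.seqAt ℓ.idx).inst σ).antAt ℓ.side ℓ.path

/-- The operational term `a` is principal in `r`, at the given place of the conclusion. -/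
def Rule.Principal {P F A : Type u} (r : Rule P F A) {T : Ty} (a : Term P F A T)
    (d : Side) (p : List Side) : Prop :=
  r.concl.subAt d p = some ⟨T, .leaf (.term a)⟩

/-! ### Quasi-properly displayable multi-type calculi -/

namespace Calculus

variable {P F A : Type u} (C : Calculus P F A)

/-- All applications of cut to derivable premises with cut term of type `T` are of the shape
`x ⊢ a, a ⊢ a / x ⊢ a` or `a ⊢ a, a ⊢ y / a ⊢ y`. -/
def TrivialCuts (T : Ty) : Prop :=
  ∀ (x : Str (Term P F A) T) (a : Term P F A T) (y : Str (Term P F A) T),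
    C.Derivable (x ⊢ₛ .leaf a) → C.Derivable (.leaf a ⊢ₛ y) → x = .leaf a ∨ y = .leaf a

/-- Every substructure of a derivable sequent that is not in the scope of a severe connective can be
displayed, on the side given by its position, by means of display postulates. -/
def DisplayProperty : Prop :=
  ∀ s, C.Derivable s → ∀ d p z, s.subAt d p = some z → s.ClearAt d p →
    ∃ t, C.DisplayEquiv s t ∧ t.Displays (s.antAt d p) z

/-- Preservation of operational terms. -/
def C1 : Prop :=
  ∀ r ∈ C.rules, ∀ σ, ∀ q ∈ r.prems, ∀ (S : Ty) (a : Term P F A S), (q.inst σ).HasTerm a →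
    ∃ (T : Ty) (b : Term P F A T), (r.concl.inst σ).HasTerm b ∧ Subterm a b

/-- Shape-alikeness of parameters. -/
def C2 : Prop :=
  ∀ r ∈ C.allRules, ∀ σ, ∀ ℓ ℓ' : Loc r, Congruent r σ ℓ ℓ' →
    ∃ z, ℓ.val σ = some z ∧ ℓ'.val σ = some z

/-- Type-alikeness of parameters. -/
def C2' : Prop :=
  ∀ r ∈ C.allRules, ∀ σ, ∀ ℓ ℓ' : Loc r, Congruent r σ ℓ ℓ' →
    ∀ z z', ℓ.val σ = some z → ℓ'.val σ = some z' → z.1 = z'.1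

/-- Restricted non-proliferation: a parameter is congruent to at most one constituent of the
conclusion, except for parameters of (and their constituents within parameters of) types all cuts
of which are trivial. -/
def C3' : Prop :=
  ∀ r ∈ C.allRules, ∀ σ T n q, ∀ ℓ ℓ' : Loc r, IsParam r σ T n q ℓ → IsParam r σ T n q ℓ' →
    ℓ.idx = none → ℓ'.idx = none → ℓ = ℓ' ∨ C.TrivialCuts T

/-- Position-alikeness of parameters. -/
def C4 : Prop :=
  ∀ r ∈ C.allRules, ∀ σ, ∀ ℓ ℓ' : Loc r, Congruent r σ ℓ ℓ' → ℓ.ant σ = ℓ'.ant σ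

/-- Quasi-display of principal constituents. -/
def C5' : Prop :=
  ∀ r ∈ C.allRules, ∀ (T : Ty) (a : Term P F A T) (d : Side) (p : List Side),
    r.Principal a d p → p = [] ∨ r.prems = []

/-- Display-invariance of axioms: display postulates that do not change the type of the sequent turn
axioms into axioms; and each principal term of an axiom is in display, in the same position, in
some display-equivalent axiom. -/
def C5'' : Prop :=
  (∀ s t T, C.IsAxiom s → C.DisplayStep s t → s.OfType T → t.OfType T → C.IsAxiom t) ∧
  (∀ r ∈ C.rules, r.prems = [] → ∀ (T : Ty) (a : Term P F A T) (d : Side) (p : List Side),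
    r.Principal a d p → ∀ σ, ∃ t, C.IsAxiom t ∧ C.DisplayEquiv (r.concl.inst σ) t ∧
      t.Displays ((r.concl.inst σ).antAt d p) ⟨T, .leaf a⟩)

/-- Closure under substitution within each type: if a parametric operational term `a` in precedent
(`ant = true`) or succedent (`ant = false`) position and all the parameters congruent to it are
simultaneously replaced by a structure `z` of the same type, the result is again an application of
the same rule. -/
def SubstClosed (ant : Bool) : Prop :=
  ∀ r ∈ C.allRules, ∀ σ, ∀ ℓ : Loc r, Congruent r σ ℓ ℓ → ℓ.ant σ = ant →
    ∀ (T : Ty) (a : Term P F A T), ℓ.val σ = some ⟨T, .leaf a⟩ → ∀ z : Str (Term P F A) T,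
      ∃ σ', ∀ i, (r.seqAt i).inst σ' =
        Seq.replace z ((r.seqAt i).inst σ) {m | Congruent r σ ℓ ⟨i, m.1, m.2⟩}

/-- Eliminability of matching principal constituents: if `a` is principal and in display in the
conclusions `x ⊢ a` and `a ⊢ y` of two rule applications, then `x ⊢ y` is derivable from the
premises of these two applications using only cuts on proper subterms of `a`. -/
def C8' : Prop :=
  ∀ r₁ ∈ C.rules, ∀ r₂ ∈ C.rules, ∀ (σ₁ σ₂ : Asg P F A) (T : Ty) (a : Term P F A T)
    (x y : Str (Term P F A) T), r₁.Principal a .right [] → r₂.Principal a .left [] →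
    r₁.concl.inst σ₁ = (x ⊢ₛ .leaf a) → r₂.concl.inst σ₂ = (.leaf a ⊢ₛ y) →
    Derives (C.rules ∪ {r | ∃ (S : Ty) (b : Term P F A S), ProperSubterm b a ∧ r = cutRule b})
      Set.univ
      ({s | ∃ q ∈ r₁.prems, s = q.inst σ₁} ∪ {s | ∃ q ∈ r₂.prems, s = q.inst σ₂}) (x ⊢ₛ y)

/-- Closure of axioms under cut. -/
def C8'' : Prop :=
  ∀ (S T U : Ty) (x : Str (Term P F A) S) (a : Term P F A T) (y : Str (Term P F A) U),
    C.IsAxiom (x ⊢ₛ .leaf a) → C.IsAxiom (.leaf a ⊢ₛ y) → C.IsAxiom (x ⊢ₛ y)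

/-- Type-uniformity of derivable sequents. -/
def C9 : Prop := ∀ s, C.Derivable s → s.TypeUniform

end Calculus

/-- Strong type-uniformity of cut rules: premises and conclusion are of the same type. -/
def C10 (P F A : Type u) : Prop :=
  ∀ r ∈ cutRules P F A, ∀ σ, ∃ T, (r.concl.inst σ).OfType T ∧ ∀ q ∈ r.prems, (q.inst σ).OfType T

structure QuasiProperlyDisplayable {P F A : Type u} (C : Calculus P F A) : Prop where
  displayProperty : C.DisplayProperty
  c1 : C.C1
  c2 : C.C2
  c2' : C.C2'
  c3' : C.C3'
  c4 : C.C4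
  c5' : C.C5'
  c5'' : C.C5''
  c6' : C.SubstClosed false
  c7' : C.SubstClosed true
  c8' : C.C8'
  c8'' : C.C8''
  c9 : C.C9
  c10 : C10 P F A

def CutElimination {P F A : Type u} (C : Calculus P F A) : Prop :=
  ∀ s, C.Derivable s → C.CutFreeDerivable s

/-- Every derivable sequent `s` has a cut-free derivation in which only subterms of operational
terms of `s` occur. -/
def SubformulaProperty {P F A : Type u} (C : Calculus P F A) : Prop :=
  ∀ s, C.Derivable s →
    Derives C.rules
      {t | ∀ (S : Ty) (a : Term P F A S), t.HasTerm a →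
        ∃ (T : Ty) (b : Term P F A T), s.HasTerm b ∧ Subterm a b} ∅ s

/-! ### The Dynamic Calculus for EAK -/

section Rules

variable {P F A : Type u}

/-- Display postulates (double lines, applicable in both directions). -/
inductive DispPair : Seq (Sch P F A) → Seq (Sch P F A) → Prop
  | semi_lt : DispPair (X 0 ⨾ X 1 ⊢ₛ X 2) (X 0 ⊢ₛ X 2 ≺ X 1)
  | lt_semi : DispPair (X 2 ⊢ₛ X 0 ⨾ X 1) (X 2 ≺ X 1 ⊢ₛ X 0)
  | semi_gt : DispPair (X 0 ⨾ X 1 ⊢ₛ X 2) (X 1 ⊢ₛ X 0 ≻ X 2)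
  | gt_semi : DispPair (X 2 ⊢ₛ X 0 ⨾ X 1) (X 0 ≻ X 2 ⊢ₛ X 1)
  | tri_arr {S T U : Ty} (s : Shade) (i : Fam S T U) :
      DispPair (tri s i (v 0) (v 1) ⊢ₛ (v 2 : Str _ U))
        ((v 1 : Str _ T) ⊢ₛ arr s.flip i (v 0) (v 2))
  | tri_lar {S T U : Ty} (s : Shade) (i : Fam S T U) :
      DispPair (tri s i (v 0) (v 1) ⊢ₛ (v 2 : Str _ U))
        ((v 0 : Str _ S) ⊢ₛ lar s.flip i (v 2) (v 1))

/-- The other structural rules with a double line; `classical` includes the Grishin rules. -/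
inductive StructPair (classical : Prop) : Seq (Sch P F A) → Seq (Sch P F A) → Prop
  | I1L : StructPair classical (X 0 ⊢ₛ X 1) (.unit ⊢ₛ X 1 ≺ X 0)
  | I1R : StructPair classical (X 0 ⊢ₛ X 1) (X 0 ≺ X 1 ⊢ₛ .unit)
  | I2L : StructPair classical (X 0 ⊢ₛ X 1) (.unit ⊢ₛ X 0 ≻ X 1)
  | I2R : StructPair classical (X 0 ⊢ₛ X 1) (X 1 ≻ X 0 ⊢ₛ .unit)
  | griL : classical → StructPair classical
      (X 0 ≻ (X 1 ⨾ X 2) ⊢ₛ X 3) ((X 0 ≻ X 1) ⨾ X 2 ⊢ₛ X 3)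
  | griR : classical → StructPair classical
      (X 3 ⊢ₛ X 0 ≻ (X 1 ⨾ X 2)) (X 3 ⊢ₛ (X 0 ≻ X 1) ⨾ X 2)

/-- The remaining structural rules, all unary: `StructRule premise conclusion`. -/
inductive StructRule : Seq (Sch P F A) → Seq (Sch P F A) → Prop
  | IWL : StructRule (.unit ⊢ₛ X 0) (X 1 ⊢ₛ X 0)
  | IWR : StructRule (X 0 ⊢ₛ .unit) (X 0 ⊢ₛ X 1)
  | W1L : StructRule (X 0 ⊢ₛ X 1) (X 2 ⊢ₛ X 1 ≺ X 0)
  | W1R : StructRule (X 0 ⊢ₛ X 1) (X 0 ≺ X 1 ⊢ₛ X 2)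
  | W2L : StructRule (X 0 ⊢ₛ X 1) (X 2 ⊢ₛ X 0 ≻ X 1)
  | W2R : StructRule (X 0 ⊢ₛ X 1) (X 1 ≻ X 0 ⊢ₛ X 2)
  | CL : StructRule (X 0 ⨾ X 0 ⊢ₛ X 1) (X 0 ⊢ₛ X 1)
  | CR : StructRule (X 1 ⊢ₛ X 0 ⨾ X 0) (X 1 ⊢ₛ X 0)
  | EL : StructRule (X 1 ⨾ X 0 ⊢ₛ X 2) (X 0 ⨾ X 1 ⊢ₛ X 2)
  | ER : StructRule (X 2 ⊢ₛ X 0 ⨾ X 1) (X 2 ⊢ₛ X 1 ⨾ X 0)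
  | AL : StructRule (X 0 ⨾ (X 1 ⨾ X 2) ⊢ₛ X 3)
      ((X 0 ⨾ X 1) ⨾ X 2 ⊢ₛ X 3)
  | AR : StructRule (X 3 ⊢ₛ (X 2 ⨾ X 1) ⨾ X 0)
      (X 3 ⊢ₛ X 2 ⨾ (X 1 ⨾ X 0))
  -- necessitation
  | necL {S : Ty} (s : Shade) (i : Fam S .fm .fm) :
      StructRule (.unit ⊢ₛ X 1) (tri s i (v 0) .unit ⊢ₛ X 1)
  | necR {S : Ty} (s : Shade) (i : Fam S .fm .fm) :
      StructRule (X 1 ⊢ₛ .unit) (X 1 ⊢ₛ arr s i (v 0) .unit)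
  -- conjugation
  | conjL {S : Ty} (s : Shade) (i : Fam S .fm .fm) :
      StructRule (tri s i (v 0) (tri s.flip i (v 0) (X 1) ⨾ X 2) ⊢ₛ X 3)
        (X 1 ⨾ tri s i (v 0) (X 2) ⊢ₛ X 3)
  | conjR {S : Ty} (s : Shade) (i : Fam S .fm .fm) :
      StructRule (X 3 ⊢ₛ arr s i (v 0) (arr s.flip i (v 0) (X 1) ⨾ X 2))
        (X 3 ⊢ₛ X 1 ⨾ arr s i (v 0) (X 2))
  -- Fischer Servi
  | FSL {S : Ty} (s : Shade) (i : Fam S .fm .fm) :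
      StructRule (arr s i (v 0) (X 1) ≻ tri s i (v 0) (X 2) ⊢ₛ X 3)
        (tri s i (v 0) (X 1 ≻ X 2) ⊢ₛ X 3)
  | FSR {S : Ty} (s : Shade) (i : Fam S .fm .fm) :
      StructRule (X 3 ⊢ₛ tri s i (v 0) (X 1) ≻ arr s i (v 0) (X 2))
        (X 3 ⊢ₛ arr s i (v 0) (X 1 ≻ X 2))
  -- monotonicity
  | monL {S : Ty} (s : Shade) (i : Fam S .fm .fm) :
      StructRule (tri s i (v 0) (X 1) ⨾ tri s i (v 0) (X 2) ⊢ₛ X 3)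
        (tri s i (v 0) (X 1 ⨾ X 2) ⊢ₛ X 3)
  | monR {S : Ty} (s : Shade) (i : Fam S .fm .fm) :
      StructRule (X 3 ⊢ₛ arr s i (v 0) (X 1) ⨾ arr s i (v 0) (X 2))
        (X 3 ⊢ₛ arr s i (v 0) (X 1 ⨾ X 2))
  -- interaction of dynamic and epistemic modalities
  | swapOutL :
      StructRule
        (tri .black .i1 (tri .black .i3 (v 0) (v 1)) (tri .black .i2 (v 0) (X 2)) ⊢ₛ
          X 3)
        (tri .black .i2 (v 0) (tri .black .i0 (v 1) (X 2)) ⊢ₛ X 3)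
  | swapOutR :
      StructRule
        (X 2 ⊢ₛ
          arr .black .i1 (tri .black .i3 (v 0) (v 1)) (arr .black .i2 (v 0) (X 3)))
        (X 2 ⊢ₛ arr .black .i2 (v 0) (arr .black .i0 (v 1) (X 3)))
  | swapInL :
      StructRule
        (tri .black .i2 (v 0) (tri .black .i0 (v 1) (X 2)) ⊢ₛ X 3)
        (tri .black .i1 (tri .black .i3 (v 0) (v 1))
            (tri .black .i2 (v 0) (tri .white .i0 (v 1) .unit ⨾ X 2)) ⊢ₛ X 3)
  | swapInR :
      StructRule
        (X 2 ⊢ₛ arr .black .i2 (v 0) (arr .black .i0 (v 1) (X 3)))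
        (X 2 ⊢ₛ
          arr .black .i1 (tri .black .i3 (v 0) (v 1))
            (arr .black .i2 (v 0) (tri .white .i0 (v 1) .unit ≻ X 3)))
  | balance :
      StructRule (X 1 ⊢ₛ X 2)
        (tri .white .i0 (v 0) (X 1) ⊢ₛ arr .white .i0 (v 0) (X 2))

/-- `F₁ ∘ (F₂ ∘ ⋯ (Fₙ ∘ p))` with `∘ ∈ {△₀, ▲₀}` and `Fⱼ` the variable number `k + j - 1`. -/
def atomL (p : P) : ℕ → List Shade → Str (Sch P F A) .fm
  | _, [] => o (.prop p)
  | k, s :: l => tri s .i0 (v k) (atomL p (k + 1) l)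

/-- `G₁ ⊳ (G₂ ⊳ ⋯ (Gₘ ⊳ p))` with `⊳ ∈ {▷₀, ▶₀}` and `Gⱼ` the variable number `k + j - 1`. -/
def atomR (p : P) : ℕ → List Shade → Str (Sch P F A) .fm
  | _, [] => o (.prop p)
  | k, s :: l => arr s .i0 (v k) (atomR p (k + 1) l)

/-- Axioms. -/
inductive Ax : Seq (Sch P F A) → Prop
  | agt (a : A) : Ax (o (.agt a) ⊢ₛ o (.agt a))
  | fnc (f : F) : Ax (o (.fnc f) ⊢ₛ o (.fnc f))
  | prop (p : P) : Ax (o (.prop p) ⊢ₛ o (.prop p))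
  | botL : Ax (o .bot ⊢ₛ .unit)
  | topR : Ax (.unit ⊢ₛ o .top)
  | atom (p : P) (l m : List Shade) : Ax (atomL p 0 l ⊢ₛ atomR p l.length m)

/-- Operational rules with at least one premise: `OpRule premises conclusion`. -/
inductive OpRule : List (Seq (Sch P F A)) → Seq (Sch P F A) → Prop
  | botR : OpRule [X 0 ⊢ₛ .unit] (X 0 ⊢ₛ o .bot)
  | topL : OpRule [.unit ⊢ₛ X 0] (o .top ⊢ₛ X 0)
  | andL (a b : Term P F A .fm) :
      OpRule [o a ⨾ o b ⊢ₛ X 0] (o (.node .and a b) ⊢ₛ X 0)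
  | andR (a b : Term P F A .fm) :
      OpRule [X 0 ⊢ₛ o a, X 1 ⊢ₛ o b]
        (X 0 ⨾ X 1 ⊢ₛ o (.node .and a b))
  | orL (a b : Term P F A .fm) :
      OpRule [o a ⊢ₛ X 0, o b ⊢ₛ X 1]
        (o (.node .or a b) ⊢ₛ X 0 ⨾ X 1)
  | orR (a b : Term P F A .fm) :
      OpRule [X 0 ⊢ₛ o a ⨾ o b] (X 0 ⊢ₛ o (.node .or a b))
  | limpL (b a : Term P F A .fm) :
      OpRule [o b ⊢ₛ X 0, X 1 ⊢ₛ o a]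
        (o (.node .limp b a) ⊢ₛ X 0 ≺ X 1)
  | limpR (b a : Term P F A .fm) :
      OpRule [X 0 ⊢ₛ o b ≺ o a] (X 0 ⊢ₛ o (.node .limp b a))
  | lexclL (b a : Term P F A .fm) :
      OpRule [o b ≺ o a ⊢ₛ X 0] (o (.node .lexcl b a) ⊢ₛ X 0)
  | lexclR (b a : Term P F A .fm) :
      OpRule [X 0 ⊢ₛ o b, o a ⊢ₛ X 1]
        (X 0 ≺ X 1 ⊢ₛ o (.node .lexcl b a))
  | impL (a b : Term P F A .fm) :
      OpRule [X 0 ⊢ₛ o a, o b ⊢ₛ X 1]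
        (o (.node .imp a b) ⊢ₛ X 0 ≻ X 1)
  | impR (a b : Term P F A .fm) :
      OpRule [X 0 ⊢ₛ o a ≻ o b] (X 0 ⊢ₛ o (.node .imp a b))
  | exclL (a b : Term P F A .fm) :
      OpRule [o a ≻ o b ⊢ₛ X 0] (o (.node .excl a b) ⊢ₛ X 0)
  | exclR (a b : Term P F A .fm) :
      OpRule [o a ⊢ₛ X 0, X 1 ⊢ₛ o b]
        (X 0 ≻ X 1 ⊢ₛ o (.node .excl a b))
  -- `△ᵢ` and `▲ᵢ`; in the left rule the structure on the right may be of any type `V`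
  | triL {S T U V : Ty} (s : Shade) (i : Fam S T U) (a : Term P F A S) (b : Term P F A T) :
      OpRule [tri s i (o a) (o b) ⊢ₛ (v 0 : Str _ V)] (o (.node (.tri s i) a b) ⊢ₛ (v 0 : Str _ V))
  | triR {S T U : Ty} (s : Shade) (i : Fam S T U) (a : Term P F A S) (b : Term P F A T) :
      OpRule [(v 0 : Str _ S) ⊢ₛ o a, (v 1 : Str _ T) ⊢ₛ o b]
        (tri s i (v 0) (v 1) ⊢ₛ o (.node (.tri s i) a b))
  | arrL {S : Ty} (s : Shade) (i : Fam S .fm .fm) (a : Term P F A S) (b : Term P F A .fm) :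
      OpRule [(v 0 : Str _ S) ⊢ₛ o a, o b ⊢ₛ X 1]
        (o (.node (.arr s i) a b) ⊢ₛ arr s i (v 0) (X 1))
  | arrR {S : Ty} (s : Shade) (i : Fam S .fm .fm) (a : Term P F A S) (b : Term P F A .fm) :
      OpRule [X 0 ⊢ₛ arr s i (o a) (o b)]
        (X 0 ⊢ₛ o (.node (.arr s i) a b))

end Rules

def displayRules (P F A : Type u) : Set (Rule P F A) :=
  {r | ∃ s t, (DispPair s t ∨ DispPair t s) ∧ r = ⟨[s], t⟩}

/-- The Dynamic Calculus for EAK over atomic propositions `P`, functional actions `F`, agents `A`;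
on a classical propositional base if `classical` holds, on the intuitionistic base otherwise. -/
def dynamicCalculus (P F A : Type u) (classical : Prop) : Calculus P F A where
  rules := displayRules P F A ∪
    {r | ∃ s t, (StructPair classical s t ∨ StructPair classical t s) ∧ r = ⟨[s], t⟩} ∪
    {r | ∃ s t, StructRule s t ∧ r = ⟨[s], t⟩} ∪
    {r | ∃ s, Ax s ∧ r = ⟨[], s⟩} ∪
    {r | ∃ l s, OpRule l s ∧ r = ⟨l, s⟩}
  display := displayRules P F A
  display_subset := fun _ h => Or.inl (Or.inl (Or.inl (Or.inl h)))

end DynCalc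

namespace DynCalc

/-! The conditions reduce to a finite inspection of rule schemas. `Rule.Regular` records what is
needed: each variable occurrence of a premise recurs in the conclusion with the same type and
position; a variable occurs twice in the conclusion only at type `ag` or `fnc` and in precedent
position (as in balance and swap-in); no premise schema has a severe connective; operational terms
of a conclusion are in display, except in axioms; and a conclusion is as type-uniform as some
premise, or uniform by itself. Position-alikeness, restricted non-proliferation, quasi-display and
type-uniformity follow from regularity, preservation of terms with the help of
`Rule.TermsPreserved`. Shape-alikeness and closure under substitution hold for every schematic
calculus. The Grishin rules are merely further regular schemas, so both bases are treated together.

Cuts at types `ag` and `fnc` are trivial because no rule other than an identity axiom or cut can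
conclude `x ⊢ a` there (`eq_leaf_of_derivable`). This excuses the proliferation of agents and
functional actions.

Cut elimination is by induction on the cut term `a`. If `a` is principal on both sides,
`RightIntro.cut` reduces the cut to cuts on immediate subterms, using residuation. In general the
occurrences of `a` are traced up a cut-free derivation and replaced by the structure on the other
side of the cut; where an occurrence becomes principal, a principal cut is made
(`PrincipalCut.rep`). Not all occurrences of `a` are replaced, so two copies of one parameter might
be treated differently. The relation `Rep` rules this out: it never enters the scope of a severe
connective, and every connective with value `ag` or `fnc` is severe in precedent position, so the
parameters that may be duplicated remain unchanged (`Rep.eq_of_action`). Since premise schemas have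
no severe connectives, the restriction persists up the derivation.

Atom axioms are handled through their chains: displaying the atom gives another atom axiom, and two
of them compose along a bare atom. The subformula property is then preservation of terms applied
along a cut-free derivation. -/

instance : DecidableEq Ty := fun a b => by
  cases a <;> cases b <;> first | exact isTrue rfl | exact isFalse (by intro h; cases h)

/-! ### Paths in generation trees. -/

section Paths

variable {L : Ty → Type u}

@[simp] theorem Str.subAt_nil {T : Ty} (x : Str L T) : x.subAt [] = some ⟨T, x⟩ := by
  cases x <;> rfl

@[simp] theorem Str.subAt_node_left {T₁ T₂ T : Ty} (c : Conn T₁ T₂ T) (x : Str L T₁)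
    (y : Str L T₂) (p : List Side) : (Str.node c x y).subAt (.left :: p) = x.subAt p := rfl

@[simp] theorem Str.subAt_node_right {T₁ T₂ T : Ty} (c : Conn T₁ T₂ T) (x : Str L T₁)
    (y : Str L T₂) (p : List Side) : (Str.node c x y).subAt (.right :: p) = y.subAt p := rfl

@[simp] theorem Str.subAt_leaf_cons {T : Ty} (a : L T) (d : Side) (p : List Side) :
    (Str.leaf a).subAt (d :: p) = none := by cases d <;> rfl

@[simp] theorem Str.subAt_unit_cons (d : Side) (p : List Side) :
    (Str.unit : Str L .fm).subAt (d :: p) = none := by cases d <;> rfl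

@[simp] theorem Str.negAt_nil {T : Ty} (x : Str L T) : x.negAt [] = false := by
  cases x <;> rfl

@[simp] theorem Str.negAt_node_left {T₁ T₂ T : Ty} (c : Conn T₁ T₂ T) (x : Str L T₁)
    (y : Str L T₂) (p : List Side) :
    (Str.node c x y).negAt (.left :: p) = xor c.neg₁ (x.negAt p) := rfl

@[simp] theorem Str.negAt_node_right {T₁ T₂ T : Ty} (c : Conn T₁ T₂ T) (x : Str L T₁)
    (y : Str L T₂) (p : List Side) :
    (Str.node c x y).negAt (.right :: p) = xor c.neg₂ (y.negAt p) := rfl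

theorem Str.subAt_append {S T : Ty} (x : Str L T) (z : Str L S) (p q : List Side)
    (h : x.subAt p = some ⟨S, z⟩) : x.subAt (p ++ q) = z.subAt q := by
  induction x generalizing p with
  | leaf a =>
    cases p with
    | nil => cases h; rfl
    | cons d p => simp at h
  | unit =>
    cases p with
    | nil => cases h; rfl
    | cons d p => simp at h
  | node c x y ihx ihy =>
    cases p with
    | nil => cases h; rfl
    | cons d p =>
      cases d
      · exact ihx p h
      · exact ihy p h

/-- Two paths to leaves, one of which extends the other, are equal. -/
theorem Str.subAt_leaf_unique {S S' T : Ty} (x : Str L T) (a : L S) (a' : L S')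
    (p p' q q' : List Side) (h : x.subAt p = some ⟨S, .leaf a⟩)
    (h' : x.subAt p' = some ⟨S', .leaf a'⟩) (e : p ++ q = p' ++ q') : p = p' := by
  rcases List.append_eq_append_iff.1 e with ⟨t, rfl, -⟩ | ⟨t, rfl, -⟩
  · rw [x.subAt_append _ p t h] at h'
    cases t with
    | nil => simp
    | cons d t => simp at h'
  · rw [x.subAt_append _ p' t h'] at h
    cases t with
    | nil => simp
    | cons d t => simp at h

end Paths

/-! ### Schemas, their instances, and the consequences of regularity. -/

section Schemas

variable {P F A : Type u}

/-- The occurrences of structure variables in a schema that is itself in precedent (`b = true`) or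
succedent (`b = false`) position: type, number and position. -/
def Str.occs : {T : Ty} → Bool → Str (Sch P F A) T → List (Ty × ℕ × Bool)
  | T, b, .leaf (.var n) => [(T, n, b)]
  | _, _, .leaf (.term _) => []
  | _, _, .unit => []
  | _, b, .node c x y => x.occs (xor b c.neg₁) ++ y.occs (xor b c.neg₂)

def Seq.occs (s : Seq (Sch P F A)) : List (Ty × ℕ × Bool) := s.l.occs true ++ s.r.occs false

/-- The operational terms of a schema. -/
def Str.terms : {T : Ty} → Str (Sch P F A) T → List (Σ S : Ty, Term P F A S)
  | T, .leaf (.term a) => [⟨T, a⟩]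
  | _, .leaf (.var _) => []
  | _, .unit => []
  | _, .node _ x y => x.terms ++ y.terms

def Seq.terms (s : Seq (Sch P F A)) : List (Σ S : Ty, Term P F A S) := s.l.terms ++ s.r.terms

/-- No severe connective occurs in the schema. -/
def Str.NoSevere : {T : Ty} → Bool → Str (Sch P F A) T → Prop
  | _, _, .leaf _ => True
  | _, _, .unit => True
  | _, b, .node c x y => ¬ c.Severe b ∧ x.NoSevere (xor b c.neg₁) ∧ y.NoSevere (xor b c.neg₂)

def Seq.NoSevere (s : Seq (Sch P F A)) : Prop := s.l.NoSevere true ∧ s.r.NoSevere false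

/-- Different occurrences of one variable are allowed only at the types of agents and functional
actions, in precedent position. -/
def Compat (o o' : Ty × ℕ × Bool) : Prop :=
  o.1 = o'.1 → o.2.1 = o'.2.1 → (o.1 = .ag ∨ o.1 = .fnc) ∧ o.2.2 = true ∧ o'.2.2 = true

/-- The operational terms of the schema are not inside a larger schema. -/
def Str.TopTerms {T : Ty} (x : Str (Sch P F A) T) : Prop :=
  x.terms = [] ∨ ∃ a, x = .leaf (.term a)

/-- The properties of a rule schema that make substitution for parameters work. -/
structure Rule.Regular (r : Rule P F A) : Prop where
  occs_prem : ∀ q ∈ r.prems, q.occs ⊆ r.concl.occs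
  compat : r.concl.occs.Pairwise Compat
  noSevere : ∀ q ∈ r.prems, q.NoSevere
  topTerms : r.prems = [] ∨ (r.concl.l.TopTerms ∧ r.concl.r.TopTerms)
  uniform : r.concl.lt = r.concl.rt ∨ ∃ q ∈ r.prems, q.lt = r.concl.lt ∧ q.rt = r.concl.rt

/-- The operational terms of the premises are subterms of those of the conclusion. -/
def Rule.TermsPreserved (r : Rule P F A) : Prop :=
  ∀ q ∈ r.prems, ∀ a ∈ q.terms, ∃ b ∈ r.concl.terms, Subterm a.2 b.2

theorem Str.subAt_inst (σ : Asg P F A) {S T : Ty} (x : Str (Sch P F A) T) (n : ℕ)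
    (p q : List Side) (h : x.subAt p = some ⟨S, .leaf (.var n)⟩) :
    (x.inst σ).subAt (p ++ q) = (σ S n).subAt q := by
  induction x generalizing p with
  | leaf a =>
    cases p with
    | nil => cases h; rfl
    | cons d p => simp at h
  | unit => cases p <;> first | cases h | simp at h
  | node c x y ihx ihy =>
    cases p with
    | nil => cases h
    | cons d p =>
      cases d
      · exact ihx p h
      · exact ihy p h

theorem Str.negAt_inst (σ : Asg P F A) {S T : Ty} (x : Str (Sch P F A) T) (n : ℕ)
    (p q : List Side) (h : x.subAt p = some ⟨S, .leaf (.var n)⟩) :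
    (x.inst σ).negAt (p ++ q) = xor (x.negAt p) ((σ S n).negAt q) := by
  induction x generalizing p with
  | leaf a =>
    cases p with
    | nil => cases h; simp [Str.inst]
    | cons d p => simp at h
  | unit => cases p <;> first | cases h | simp at h
  | node c x y ihx ihy =>
    cases p with
    | nil => cases h
    | cons d p =>
      cases d
      · simp [Str.inst, ihx p h]
      · simp [Str.inst, ihy p h]

theorem Str.mem_occs {S T : Ty} (x : Str (Sch P F A) T) (b : Bool) (n : ℕ) (p : List Side)
    (h : x.subAt p = some ⟨S, .leaf (.var n)⟩) : (S, n, xor b (x.negAt p)) ∈ x.occs b := by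
  induction x generalizing p b with
  | leaf a =>
    cases p with
    | nil => cases h; simp [Str.occs]
    | cons d p => simp at h
  | unit => cases p <;> first | cases h | simp at h
  | node c x y ihx ihy =>
    cases p with
    | nil => cases h
    | cons d p =>
      cases d
      · have := ihx (xor b c.neg₁) p h
        simp only [Str.occs, Str.negAt_node_left, List.mem_append]
        left; simpa using this
      · have := ihy (xor b c.neg₂) p h
        simp only [Str.occs, Str.negAt_node_right, List.mem_append]
        right; simpa using this

theorem Seq.mem_occs (s : Seq (Sch P F A)) {S : Ty} (n : ℕ) (d : Side) (p : List Side)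
    (h : s.subAt d p = some ⟨S, .leaf (.var n)⟩) : (S, n, s.antAt d p) ∈ s.occs := by
  cases d
  · have := s.l.mem_occs true n p h
    simp only [Seq.occs, List.mem_append, Seq.antAt]
    left; simpa using this
  · have := s.r.mem_occs false n p h
    simp only [Seq.occs, List.mem_append, Seq.antAt]
    right; simpa using this

theorem Str.exists_subAt_of_mem_occs {S T : Ty} (x : Str (Sch P F A) T) (b b' : Bool) (n : ℕ)
    (h : (S, n, b') ∈ x.occs b) : ∃ p, x.subAt p = some ⟨S, .leaf (.var n)⟩ := by
  induction x generalizing b with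
  | leaf a =>
    cases a with
    | var m =>
      simp only [Str.occs, List.mem_singleton, Prod.mk.injEq] at h
      obtain ⟨rfl, rfl, rfl⟩ := h
      exact ⟨[], rfl⟩
    | term a => simp [Str.occs] at h
  | unit => simp [Str.occs] at h
  | node c x y ihx ihy =>
    rcases List.mem_append.1 h with h | h
    · obtain ⟨p, hp⟩ := ihx _ h
      exact ⟨.left :: p, hp⟩
    · obtain ⟨p, hp⟩ := ihy _ h
      exact ⟨.right :: p, hp⟩

theorem Str.exists_subAt_of_mem_terms {T : Ty} (x : Str (Sch P F A) T)
    (a : Σ S : Ty, Term P F A S) (h : a ∈ x.terms) :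
    ∃ p, x.subAt p = some ⟨a.1, .leaf (.term a.2)⟩ := by
  induction x with
  | leaf b =>
    cases b with
    | var m => simp [Str.terms] at h
    | term b =>
      simp only [Str.terms, List.mem_singleton] at h
      subst h
      exact ⟨[], rfl⟩
  | unit => simp [Str.terms] at h
  | node c x y ihx ihy =>
    rcases List.mem_append.1 h with h | h
    · obtain ⟨p, hp⟩ := ihx h
      exact ⟨.left :: p, hp⟩
    · obtain ⟨p, hp⟩ := ihy h
      exact ⟨.right :: p, hp⟩

theorem Str.mem_terms {S T : Ty} (x : Str (Sch P F A) T) (a : Term P F A S) (p : List Side)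
    (h : x.subAt p = some ⟨S, .leaf (.term a)⟩) : ⟨S, a⟩ ∈ x.terms := by
  induction x generalizing p with
  | leaf b =>
    cases p with
    | nil => cases h; simp [Str.terms]
    | cons d p => simp at h
  | unit => cases p <;> first | cases h | simp at h
  | node c x y ihx ihy =>
    cases p with
    | nil => cases h
    | cons d p =>
      cases d
      · exact List.mem_append_left _ (ihx p h)
      · exact List.mem_append_right _ (ihy p h)

theorem Str.subAt_inst_term (σ : Asg P F A) {S T : Ty} (x : Str (Sch P F A) T)
    (a : Term P F A S) (p : List Side) (h : x.subAt p = some ⟨S, .leaf (.term a)⟩) :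
    (x.inst σ).subAt p = some ⟨S, .leaf a⟩ := by
  induction x generalizing p with
  | leaf b =>
    cases p with
    | nil => cases h; rfl
    | cons d p => simp at h
  | unit => cases p <;> first | cases h | simp at h
  | node c x y ihx ihy =>
    cases p with
    | nil => cases h
    | cons d p =>
      cases d
      · exact ihx p h
      · exact ihy p h

/-- An operational term of an instance comes from the schema or from the assignment. -/
theorem Str.subAt_inst_leaf (σ : Asg P F A) {S T : Ty} (x : Str (Sch P F A) T) (b : Bool)
    (a : Term P F A S) (p : List Side) (h : (x.inst σ).subAt p = some ⟨S, .leaf a⟩) :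
    ⟨S, a⟩ ∈ x.terms ∨
      ∃ T' n b' q, (T', n, b') ∈ x.occs b ∧ (σ T' n).subAt q = some ⟨S, .leaf a⟩ := by
  induction x generalizing p b with
  | leaf c =>
    cases c with
    | var m => exact Or.inr ⟨_, m, b, p, by simp [Str.occs], h⟩
    | term c =>
      cases p with
      | nil => cases h; simp [Str.terms]
      | cons d p => simp [Str.inst] at h
  | unit => cases p <;> first | cases h | simp [Str.inst] at h
  | node c x y ihx ihy =>
    cases p with
    | nil => cases h
    | cons d p =>
      cases d
      · rcases ihx (xor b c.neg₁) p h with h | ⟨T', n, b', q, h, h'⟩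
        · exact Or.inl (List.mem_append_left _ h)
        · exact Or.inr ⟨T', n, b', q, List.mem_append_left _ h, h'⟩
      · rcases ihy (xor b c.neg₂) p h with h | ⟨T', n, b', q, h, h'⟩
        · exact Or.inl (List.mem_append_right _ h)
        · exact Or.inr ⟨T', n, b', q, List.mem_append_right _ h, h'⟩

theorem Seq.hasTerm_inst_iff (σ : Asg P F A) {S : Ty} (s : Seq (Sch P F A)) (a : Term P F A S) :
    (s.inst σ).HasTerm a ↔ ⟨S, a⟩ ∈ s.terms ∨
      ∃ T n b q, (T, n, b) ∈ s.occs ∧ (σ T n).subAt q = some ⟨S, .leaf a⟩ := by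
  constructor
  · rintro ⟨d, p, h⟩
    cases d
    · rcases s.l.subAt_inst_leaf σ true a p h with h | ⟨T, n, b, q, h, h'⟩
      · exact Or.inl (List.mem_append_left _ h)
      · exact Or.inr ⟨T, n, b, q, List.mem_append_left _ h, h'⟩
    · rcases s.r.subAt_inst_leaf σ false a p h with h | ⟨T, n, b, q, h, h'⟩
      · exact Or.inl (List.mem_append_right _ h)
      · exact Or.inr ⟨T, n, b, q, List.mem_append_right _ h, h'⟩
  · rintro (h | ⟨T, n, b, q, h, h'⟩)
    · rcases List.mem_append.1 h with h | h
      · obtain ⟨p, hp⟩ := s.l.exists_subAt_of_mem_terms _ h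
        exact ⟨.left, p, s.l.subAt_inst_term σ a p hp⟩
      · obtain ⟨p, hp⟩ := s.r.exists_subAt_of_mem_terms _ h
        exact ⟨.right, p, s.r.subAt_inst_term σ a p hp⟩
    · rcases List.mem_append.1 h with h | h
      · obtain ⟨p, hp⟩ := s.l.exists_subAt_of_mem_occs _ _ _ h
        exact ⟨.left, p ++ q, (s.l.subAt_inst σ n p q hp).trans h'⟩
      · obtain ⟨p, hp⟩ := s.r.exists_subAt_of_mem_occs _ _ _ h
        exact ⟨.right, p ++ q, (s.r.subAt_inst σ n p q hp).trans h'⟩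

theorem Seq.subAt_inst (σ : Asg P F A) {S : Ty} (s : Seq (Sch P F A)) (n : ℕ) (d : Side)
    (p q : List Side) (h : s.subAt d p = some ⟨S, .leaf (.var n)⟩) :
    (s.inst σ).subAt d (p ++ q) = (σ S n).subAt q := by
  cases d
  · exact s.l.subAt_inst σ n p q h
  · exact s.r.subAt_inst σ n p q h

theorem Seq.antAt_inst (σ : Asg P F A) {S : Ty} (s : Seq (Sch P F A)) (n : ℕ) (d : Side)
    (p q : List Side) (h : s.subAt d p = some ⟨S, .leaf (.var n)⟩) :
    (s.inst σ).antAt d (p ++ q) = xor (s.antAt d p) ((σ S n).negAt q) := by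
  cases d
  · simp [Seq.antAt, Seq.inst, s.l.negAt_inst σ n p q h]
  · simp [Seq.antAt, Seq.inst, s.r.negAt_inst σ n p q h]

theorem IsParam.val_eq {r : Rule P F A} {σ : Asg P F A} {T : Ty} {n : ℕ} {q : List Side}
    {ℓ : Loc r} (h : IsParam r σ T n q ℓ) : ℓ.val σ = (σ T n).subAt q := by
  obtain ⟨-, p, hp, h⟩ := h
  rw [Loc.val, hp, Seq.subAt_inst σ _ n _ p q h]

theorem Congruent.exists_val {r : Rule P F A} {σ : Asg P F A} {ℓ ℓ' : Loc r}
    (h : Congruent r σ ℓ ℓ') : ∃ z, ℓ.val σ = some z ∧ ℓ'.val σ = some z := by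
  obtain ⟨T, n, q, h, h'⟩ := h
  obtain ⟨z, hz⟩ := Option.isSome_iff_exists.1 h.1
  exact ⟨z, h.val_eq.trans hz, h'.val_eq.trans hz⟩

/-- Occurrences in opposite positions are different entries of the list, and for these `Compat`
forces both positions to be precedent. -/
theorem Compat.pos_eq {l : List (Ty × ℕ × Bool)} (hl : l.Pairwise Compat) {T : Ty} {n : ℕ}
    {b b' : Bool} (h : (T, n, b) ∈ l) (h' : (T, n, b') ∈ l) : b = b' := by
  by_contra hb
  have hs : ∀ o o' : Ty × ℕ × Bool, Compat o o' → Compat o' o := fun o o' h e e' => by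
    obtain ⟨h₁, h₂, h₃⟩ := h e.symm e'.symm
    exact ⟨e ▸ h₁, h₃, h₂⟩
  -- `Compat` is symmetric but not reflexive; weakening it by `o ≠ o'` makes the diagonal vacuous,
  -- so that `Pairwise` extends to all pairs of members.
  have : Std.Symm fun o o' : Ty × ℕ × Bool => o ≠ o' → Compat o o' :=
    ⟨fun o o' h e => hs _ _ (h e.symm)⟩
  have h3 : Compat (T, n, b) (T, n, b') :=
    List.Pairwise.forall_of_forall (R := fun o o' => o ≠ o' → Compat o o')
      (fun o _ e => (e rfl).elim)
      (hl.imp (S := fun o o' => o ≠ o' → Compat o o') fun h _ => h) h h' (by simpa using hb)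
  obtain ⟨-, h₁, h₂⟩ := h3 rfl rfl
  exact hb (h₁.trans h₂.symm)

theorem Rule.Regular.mem_concl_occs {r : Rule P F A} (hr : r.Regular)
    (i : Option (Fin r.prems.length)) {o : Ty × ℕ × Bool} (h : o ∈ (r.seqAt i).occs) :
    o ∈ r.concl.occs := by
  cases i with
  | none => exact h
  | some k => exact hr.occs_prem _ (List.get_mem _ _) h

/-- A position is the position of the variable in the schema combined with that of the constituent
inside the substituted structure. Congruent parameters share the latter, and all occurrences of a
variable share the former. -/
theorem Rule.Regular.ant_eq {r : Rule P F A} (hr : r.Regular) {σ : Asg P F A} {ℓ ℓ' : Loc r}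
    (h : Congruent r σ ℓ ℓ') : ℓ.ant σ = ℓ'.ant σ := by
  obtain ⟨T, n, q, ⟨-, p, hp, h⟩, -, p', hp', h'⟩ := h
  rw [Loc.ant, Loc.ant, hp, hp', Seq.antAt_inst σ _ n _ p q h, Seq.antAt_inst σ _ n _ p' q h']
  congr 1
  exact Compat.pos_eq hr.compat (hr.mem_concl_occs _ (Seq.mem_occs _ _ _ _ h))
    (hr.mem_concl_occs _ (Seq.mem_occs _ _ _ _ h'))

/-- Two different paths part at some node and so give entries in the two halves of the list of
occurrences there, which `Compat` allows only at types `ag` and `fnc`. -/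
theorem Str.path_unique {S T : Ty} (x : Str (Sch P F A) T) (b : Bool) (n : ℕ)
    (hx : (x.occs b).Pairwise Compat) (hS : ¬ (S = .ag ∨ S = .fnc)) (p p' : List Side)
    (h : x.subAt p = some ⟨S, .leaf (.var n)⟩) (h' : x.subAt p' = some ⟨S, .leaf (.var n)⟩) :
    p = p' := by
  induction x generalizing p p' b with
  | leaf a =>
    cases p with
    | nil =>
      cases p' with
      | nil => rfl
      | cons d p' => simp at h'
    | cons d p => simp at h
  | unit => cases p <;> first | cases h | simp at h
  | node c x y ihx ihy =>
    obtain ⟨h₁, h₂, h₃⟩ := List.pairwise_append.1 hx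
    cases p with
    | nil => cases h
    | cons d p =>
      cases p' with
      | nil => cases h'
      | cons d' p' =>
        cases d <;> cases d'
        · rw [ihx _ h₁ p p' h h']
        · exact (hS (h₃ _ (x.mem_occs _ _ _ h) _ (y.mem_occs _ _ _ h') rfl rfl).1).elim
        · exact (hS (h₃ _ (x.mem_occs _ _ _ h') _ (y.mem_occs _ _ _ h) rfl rfl).1).elim
        · rw [ihy _ h₂ p p' h h']

theorem Rule.Regular.eq_of_isParam {r : Rule P F A} (hr : r.Regular) {σ : Asg P F A} {T : Ty}
    {n : ℕ} {q : List Side} {ℓ ℓ' : Loc r} (h : IsParam r σ T n q ℓ) (h' : IsParam r σ T n q ℓ')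
    (hi : ℓ.idx = none) (hi' : ℓ'.idx = none) (hT : ¬ (T = .ag ∨ T = .fnc)) : ℓ = ℓ' := by
  obtain ⟨i, d, p⟩ := ℓ
  obtain ⟨i', d', p'⟩ := ℓ'
  obtain ⟨-, p₀, rfl, h⟩ := h
  obtain ⟨-, p₀', rfl, h'⟩ := h'
  cases hi
  cases hi'
  obtain ⟨h₁, h₂, h₃⟩ := List.pairwise_append.1 hr.compat
  cases d <;> cases d'
  · rw [Str.path_unique _ _ n h₁ hT p₀ p₀' h h']
  · exact (hT (h₃ _ (Str.mem_occs _ _ _ _ h) _ (Str.mem_occs _ _ _ _ h') rfl rfl).1).elim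
  · exact (hT (h₃ _ (Str.mem_occs _ _ _ _ h') _ (Str.mem_occs _ _ _ _ h) rfl rfl).1).elim
  · rw [Str.path_unique _ _ n h₂ hT p₀ p₀' h h']

theorem Str.replace_empty {L : Ty → Type u} {S T : Ty} (z : Str L S) (x : Str L T) :
    Str.replace z x ∅ = x := by
  induction x with
  | leaf a => simp [Str.replace]
  | unit => rfl
  | node c x y ihx ihy => simpa [Str.replace] using ⟨ihx, ihy⟩

/-- A change in the value of one variable shows up at the corresponding place of each of its
occurrences and nowhere else, so simultaneous replacement is absorbed by the assignment. -/
theorem Str.inst_replace (σ : Asg P F A) {R S T : Ty} (z : Str (Term P F A) R) (n : ℕ)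
    (q : List Side) (x : Str (Sch P F A) T) :
    x.inst (fun T' m => Str.replace z (σ T' m) {q' | q' = q ∧ T' = S ∧ m = n}) =
      Str.replace z (x.inst σ) {q' | ∃ p, q' = p ++ q ∧ x.subAt p = some ⟨S, .leaf (.var n)⟩} := by
  induction x with
  | leaf a =>
    cases a with
    | var m =>
      simp only [Str.inst]
      congr 1
      ext q'
      constructor
      · rintro ⟨rfl, rfl, rfl⟩
        exact ⟨[], rfl, rfl⟩
      · rintro ⟨p, rfl, h⟩
        cases p with
        | nil => cases h; exact ⟨rfl, rfl, rfl⟩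
        | cons d p => simp at h
    | term a =>
      have : {q' | ∃ p, q' = p ++ q ∧ (Str.leaf (Sch.term a)).subAt p =
          some ⟨S, .leaf (.var n)⟩} = (∅ : Set (List Side)) := by
        ext q'
        simp only [Set.mem_ofPred_eq, Set.mem_empty_iff_false, iff_false]
        rintro ⟨p, -, h⟩
        cases p with
        | nil => cases h
        | cons d p => simp at h
      rw [this, Str.replace_empty]
      rfl
  | unit => rfl
  | node c x y ihx ihy =>
    simp only [Str.inst, Str.replace, ihx, ihy]
    congr 2
    · ext q'
      constructor
      · rintro ⟨p, rfl, h⟩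
        exact ⟨.left :: p, rfl, h⟩
      · rintro ⟨p, e, h⟩
        cases p with
        | nil => cases h
        | cons d p =>
          simp only [List.cons_append, List.cons.injEq] at e
          obtain ⟨rfl, rfl⟩ := e
          exact ⟨p, rfl, h⟩
    · ext q'
      constructor
      · rintro ⟨p, rfl, h⟩
        exact ⟨.right :: p, rfl, h⟩
      · rintro ⟨p, e, h⟩
        cases p with
        | nil => cases h
        | cons d p =>
          simp only [List.cons_append, List.cons.injEq] at e
          obtain ⟨rfl, rfl⟩ := e
          exact ⟨p, rfl, h⟩

theorem Seq.subAt_leaf_unique {L : Ty → Type u} {S S' : Ty} (s : Seq L) (a : L S) (a' : L S')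
    (d : Side) (p p' q q' : List Side) (h : s.subAt d p = some ⟨S, .leaf a⟩)
    (h' : s.subAt d p' = some ⟨S', .leaf a'⟩) (e : p ++ q = p' ++ q') : p = p' := by
  cases d
  · exact s.l.subAt_leaf_unique a a' p p' q q' h h' e
  · exact s.r.subAt_leaf_unique a a' p p' q q' h h' e

/-- Paths to distinct leaves of a schema are incomparable, so an occurrence determines the variable
and the inner path it comes from; the existential in `Congruent` has only one candidate. -/
theorem IsParam.congruent_iff {r : Rule P F A} {σ : Asg P F A} {T : Ty} {n : ℕ} {q : List Side}
    {ℓ : Loc r} (h : IsParam r σ T n q ℓ) (ℓ' : Loc r) :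
    Congruent r σ ℓ ℓ' ↔
      ∃ p, ℓ'.path = p ++ q ∧ (r.seqAt ℓ'.idx).subAt ℓ'.side p = some ⟨T, .leaf (.var n)⟩ := by
  constructor
  · rintro ⟨T', n', q', ⟨-, p₁, h₁, h₁'⟩, -, h₂⟩
    obtain ⟨-, p, hp, h⟩ := h
    have e := Seq.subAt_leaf_unique _ _ _ _ _ _ _ _ h h₁' (hp.symm.trans h₁)
    subst e
    rw [h] at h₁'
    cases h₁'
    rw [hp] at h₁
    cases List.append_cancel_left h₁
    exact h₂
  · rintro h'
    exact ⟨T, n, q, h, h.1, h'⟩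

/-- Parameters may be replaced by structures, in all rules. -/
theorem Calculus.substClosed (C : Calculus P F A) (ant : Bool) : C.SubstClosed ant := by
  rintro r - σ ℓ ⟨S, n, q, h, -⟩ - T a - z
  -- Only the variable to which `ℓ` belongs gets a new value; by `congruent_iff` this affects
  -- exactly the congruence class of `ℓ`.
  refine ⟨fun T' m => Str.replace z (σ T' m) {q' | q' = q ∧ T' = S ∧ m = n}, fun i => ?_⟩
  simp only [h.congruent_iff]
  simp only [Seq.inst, Seq.replace, Str.inst_replace]
  rfl

/-- A term of a premise is either displayed by the schema, where `TermsPreserved` applies, or lies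
inside a parameter, which recurs in the conclusion. -/
theorem Rule.subterm_of_hasTerm_prem {r : Rule P F A} (h₁ : r.Regular) (h₂ : r.TermsPreserved) (σ : Asg P F A)
    (q : Seq (Sch P F A)) (hq : q ∈ r.prems) (S : Ty) (a : Term P F A S)
    (ha : (q.inst σ).HasTerm a) :
    ∃ (T : Ty) (b : Term P F A T), (r.concl.inst σ).HasTerm b ∧ Subterm a b := by
  rcases (q.hasTerm_inst_iff σ a).1 ha with ha | ⟨T, n, b, p, h, h'⟩
  · obtain ⟨b, hb, hab⟩ := h₂ q hq _ ha
    exact ⟨b.1, b.2, (r.concl.hasTerm_inst_iff σ b.2).2 (Or.inl hb), hab⟩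
  · exact ⟨S, a, (r.concl.hasTerm_inst_iff σ a).2 (Or.inr ⟨T, n, b, p, h₁.occs_prem q hq h, h'⟩),
      .refl a⟩

theorem Str.TopTerms.path_eq_nil {S T : Ty} {x : Str (Sch P F A) T} (hx : x.TopTerms)
    {a : Term P F A S} {p : List Side} (h : x.subAt p = some ⟨S, .leaf (.term a)⟩) : p = [] := by
  rcases hx with hx | ⟨b, rfl⟩
  · have := x.mem_terms a p h
    simp [hx] at this
  · cases p with
    | nil => rfl
    | cons d p => simp at h

theorem Rule.Regular.principal {r : Rule P F A} (hr : r.Regular) {T : Ty} (a : Term P F A T)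
    (d : Side) (p : List Side) (h : r.Principal a d p) : p = [] ∨ r.prems = [] := by
  rcases hr.topTerms with hp | ⟨h₁, h₂⟩
  · exact Or.inr hp
  · left
    cases d
    · exact h₁.path_eq_nil h
    · exact h₂.path_eq_nil h

end Schemas

/-! ### Regularity of the rules of the calculus, and type-uniformity. -/

section Rules

variable {P F A : Type u}

theorem DispPair.regular {s t : Seq (Sch P F A)} (h : DispPair s t) :
    Rule.Regular ⟨[s], t⟩ ∧ Rule.Regular ⟨[t], s⟩ := by
  -- Splitting on the index makes the types concrete, so that each condition is a finite check.
  cases h <;> try (rename_i i; cases i)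
  all_goals
    constructor <;> constructor <;>
      simp [Seq.occs, Str.occs, Conn.neg₁, Conn.neg₂, Compat, Seq.NoSevere, Str.NoSevere,
        Conn.Severe, Str.TopTerms, Str.terms]

theorem StructPair.regular {classical : Prop} {s t : Seq (Sch P F A)}
    (h : StructPair classical s t) :
    Rule.Regular ⟨[s], t⟩ ∧ Rule.Regular ⟨[t], s⟩ := by
  cases h <;>
    constructor <;> constructor <;>
      simp [Seq.occs, Str.occs, Conn.neg₁, Conn.neg₂, Compat, Seq.NoSevere, Str.NoSevere,
        Conn.Severe, Str.TopTerms, Str.terms]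

theorem StructRule.regular {s t : Seq (Sch P F A)} (h : StructRule s t) :
    Rule.Regular ⟨[s], t⟩ := by
  cases h <;> try (rename_i i; cases i)
  all_goals
    constructor <;>
      simp [Seq.occs, Str.occs, Conn.neg₁, Conn.neg₂, Compat, Seq.NoSevere, Str.NoSevere,
        Conn.Severe, Str.TopTerms, Str.terms]

theorem OpRule.regular {l : List (Seq (Sch P F A))} {s : Seq (Sch P F A)} (h : OpRule l s) :
    Rule.Regular ⟨l, s⟩ := by
  cases h <;> try (rename_i i _ _; cases i)
  all_goals
    constructor <;>
      simp [Seq.occs, Str.occs, Conn.neg₁, Conn.neg₂, Compat, Seq.NoSevere, Str.NoSevere,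
        Conn.Severe, Str.TopTerms, Str.terms]

theorem cutRule_regular {T : Ty} (a : Term P F A T) : (cutRule a).Regular := by
  cases T <;> constructor <;>
      simp [cutRule, Seq.occs, Str.occs, Compat, Seq.NoSevere, Str.NoSevere, Str.TopTerms,
        Str.terms]

/-- All variables of a chain have type `fnc` and precedent position, so atom axioms satisfy `Compat`
without any comparison of variable numbers. -/
theorem atomL_occs (p : P) (k : ℕ) (l : List Shade) :
    ∀ o ∈ (atomL p k l : Str (Sch P F A) .fm).occs true, o.1 = .fnc ∧ o.2.2 = true := by
  induction l generalizing k with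
  | nil => simp [atomL, Str.occs]
  | cons s l ih => simpa [atomL, Str.occs, Conn.neg₁, Conn.neg₂] using ih (k + 1)

/-- The antitone first coordinate of the arrows turns the succedent position of the chain into
precedent position for its variables. -/
theorem atomR_occs (p : P) (k : ℕ) (l : List Shade) :
    ∀ o ∈ (atomR p k l : Str (Sch P F A) .fm).occs false, o.1 = .fnc ∧ o.2.2 = true := by
  induction l generalizing k with
  | nil => simp [atomR, Str.occs]
  | cons s l ih => simpa [atomR, Str.occs, Conn.neg₁, Conn.neg₂] using ih (k + 1)

theorem Ax.regular {s : Seq (Sch P F A)} (h : Ax s) : Rule.Regular ⟨[], s⟩ := by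
  cases h
  case atom p l m =>
    have key : ∀ o ∈ (atomL p 0 l ⊢ₛ atomR p l.length m : Seq (Sch P F A)).occs,
        o.1 = .fnc ∧ o.2.2 = true := by
      intro o ho
      rcases List.mem_append.1 ho with ho | ho
      · exact atomL_occs p 0 l o ho
      · exact atomR_occs p _ m o ho
    refine ⟨by simp, ?_, by simp, by simp, by simp⟩
    exact List.pairwise_of_forall_mem_list fun o ho o' ho' _ _ =>
      ⟨Or.inr (key o ho).1, (key o ho).2, (key o' ho').2⟩
  all_goals
    constructor <;> simp [Seq.occs, Str.occs]

theorem DispPair.terms_eq_nil {s t : Seq (Sch P F A)} (h : DispPair s t) :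
    s.terms = [] ∧ t.terms = [] := by
  cases h <;> exact ⟨rfl, rfl⟩

theorem StructPair.terms_eq_nil {classical : Prop} {s t : Seq (Sch P F A)}
    (h : StructPair classical s t) : s.terms = [] ∧ t.terms = [] := by
  cases h <;> exact ⟨rfl, rfl⟩

theorem StructRule.terms_eq_nil {s t : Seq (Sch P F A)} (h : StructRule s t) :
    s.terms = [] ∧ t.terms = [] := by
  cases h <;> exact ⟨rfl, rfl⟩

theorem Subterm.child_left {S T T' : Ty} (c : OpConn S T T') (a : Term P F A S)
    (b : Term P F A T) : Subterm a (.node c a b) := .left c b (.refl a)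

theorem Subterm.child_right {S T T' : Ty} (c : OpConn S T T') (a : Term P F A S)
    (b : Term P F A T) : Subterm b (.node c a b) := .right c a (.refl b)

theorem OpRule.termsPreserved {l : List (Seq (Sch P F A))} {s : Seq (Sch P F A)}
    (h : OpRule l s) : Rule.TermsPreserved ⟨l, s⟩ := by
  cases h <;>
    simp [Rule.TermsPreserved, Seq.terms, Str.terms, Subterm.child_left, Subterm.child_right]

/-- The rules of the calculus other than cut, by kind. -/
inductive RuleKind (classical : Prop) : Rule P F A → Prop
  | disp {s t : Seq (Sch P F A)} (h : DispPair s t ∨ DispPair t s) : RuleKind classical ⟨[s], t⟩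
  | pair {s t : Seq (Sch P F A)} (h : StructPair classical s t ∨ StructPair classical t s) :
      RuleKind classical ⟨[s], t⟩
  | struct {s t : Seq (Sch P F A)} (h : StructRule s t) : RuleKind classical ⟨[s], t⟩
  | ax {s : Seq (Sch P F A)} (h : Ax s) : RuleKind classical ⟨[], s⟩
  | op {l : List (Seq (Sch P F A))} {s : Seq (Sch P F A)} (h : OpRule l s) :
      RuleKind classical ⟨l, s⟩

variable {classical : Prop}

theorem mem_rules_iff {r : Rule P F A} :
    r ∈ (dynamicCalculus P F A classical).rules ↔ RuleKind classical r := by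
  constructor
  · rintro ((((⟨s, t, h, rfl⟩ | ⟨s, t, h, rfl⟩) | ⟨s, t, h, rfl⟩) | ⟨s, h, rfl⟩) | ⟨l, s, h, rfl⟩)
    · exact .disp h
    · exact .pair h
    · exact .struct h
    · exact .ax h
    · exact .op h
  · rintro (h | h | h | h | h)
    · exact Or.inl (Or.inl (Or.inl (Or.inl ⟨_, _, h, rfl⟩)))
    · exact Or.inl (Or.inl (Or.inl (Or.inr ⟨_, _, h, rfl⟩)))
    · exact Or.inl (Or.inl (Or.inr ⟨_, _, h, rfl⟩))
    · exact Or.inl (Or.inr ⟨_, h, rfl⟩)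
    · exact Or.inr ⟨_, _, h, rfl⟩

theorem RuleKind.regular {r : Rule P F A} (h : RuleKind classical r) : r.Regular := by
  rcases h with (h | h) | (h | h) | h | h | h
  exacts [h.regular.1, h.regular.2, h.regular.1, h.regular.2, h.regular, h.regular, h.regular]

theorem RuleKind.termsPreserved {r : Rule P F A} (h : RuleKind classical r) :
    r.TermsPreserved := by
  have key : ∀ {s t : Seq (Sch P F A)}, s.terms = [] → Rule.TermsPreserved ⟨[s], t⟩ := by
    intro s t hs q hq a ha
    obtain rfl := List.mem_singleton.1 hq
    simp [hs] at ha
  rcases h with (h | h) | (h | h) | h | h | h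
  exacts [key h.terms_eq_nil.1, key h.terms_eq_nil.2, key h.terms_eq_nil.1, key h.terms_eq_nil.2,
    key h.terms_eq_nil.1, fun _ hq => (List.not_mem_nil hq).elim, h.termsPreserved]

theorem regular_of_mem_allRules {r : Rule P F A}
    (h : r ∈ (dynamicCalculus P F A classical).allRules) : r.Regular := by
  rcases h with h | ⟨T, a, rfl⟩
  · exact (mem_rules_iff.1 h).regular
  · exact cutRule_regular a

/-- Derivations from type-uniform hypotheses by regular rules are type-uniform. -/
theorem Derives.typeUniform {R : Set (Rule P F A)} {K : Set (Seq (Term P F A))}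
    (hR : ∀ r ∈ R, r.Regular) {s : Seq (Term P F A)} (h : Derives R K ∅ s) : s.lt = s.rt := by
  induction h with
  | hyp h => exact h.elim
  | @app r σ hr _ _ ih =>
    rcases (hR r hr).uniform with h | ⟨q, hq, h₁, h₂⟩
    · exact h
    · exact h₁.symm.trans ((ih q hq).trans h₂)

theorem typeUniform_of_derivable {s : Seq (Term P F A)}
    (h : (dynamicCalculus P F A classical).Derivable s) : s.lt = s.rt :=
  Derives.typeUniform (fun _ => regular_of_mem_allRules) h

end Rules

/-! ### The display property, and triviality of cuts on agents and functional actions. -/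

section Display

variable {P F A : Type u} {classical : Prop}

/-- The virtual adjoints make all types of structures inhabited. -/
def Str.default {L : Ty → Type u} : (T : Ty) → Str L T
  | .ag => lar .white .i2 .unit .unit
  | .fnc => lar .white .i0 .unit .unit
  | .act => lar .white .i1 .unit .unit
  | .fm => .unit

/-- The structure `x`, seen as a structure of type `T` if it has that type. -/
def Str.castTo {L : Ty → Type u} {S : Ty} (x : Str L S) (T : Ty) : Str L T :=
  if h : S = T then h ▸ x else Str.default T

@[simp] theorem Str.castTo_self {L : Ty → Type u} {S : Ty} (x : Str L S) : x.castTo S = x := by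
  simp [Str.castTo]

/-- The assignment of `x`, `y`, `z` to the variables `0`, `1`, `2`. -/
def Asg.triple {S T U : Ty} (x : Str (Term P F A) S) (y : Str (Term P F A) T)
    (z : Str (Term P F A) U) : Asg P F A
  | R, 0 => x.castTo R
  | R, 1 => y.castTo R
  | R, _ + 2 => z.castTo R

/-- The instances of the display postulates. -/
inductive Disp : Seq (Term P F A) → Seq (Term P F A) → Prop
  | semi_lt (x y z : Str (Term P F A) .fm) : Disp (x ⨾ y ⊢ₛ z) (x ⊢ₛ z ≺ y)
  | lt_semi (x y z : Str (Term P F A) .fm) : Disp (z ⊢ₛ x ⨾ y) (z ≺ y ⊢ₛ x)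
  | semi_gt (x y z : Str (Term P F A) .fm) : Disp (x ⨾ y ⊢ₛ z) (y ⊢ₛ x ≻ z)
  | gt_semi (x y z : Str (Term P F A) .fm) : Disp (z ⊢ₛ x ⨾ y) (x ≻ z ⊢ₛ y)
  | tri_arr {S T U : Ty} (s : Shade) (i : Fam S T U) (x : Str (Term P F A) S)
      (y : Str (Term P F A) T) (z : Str (Term P F A) U) :
      Disp (tri s i x y ⊢ₛ z) (y ⊢ₛ arr s.flip i x z)
  | tri_lar {S T U : Ty} (s : Shade) (i : Fam S T U) (x : Str (Term P F A) S)
      (y : Str (Term P F A) T) (z : Str (Term P F A) U) :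
      Disp (tri s i x y ⊢ₛ z) (x ⊢ₛ lar s.flip i z y)

theorem DispPair.disp {s t : Seq (Sch P F A)} (h : DispPair s t) (σ : Asg P F A) :
    Disp (s.inst σ) (t.inst σ) := by
  cases h <;> constructor

theorem Disp.exists_dispPair {s t : Seq (Term P F A)} (h : Disp s t) :
    ∃ s' t' : Seq (Sch P F A), ∃ σ, DispPair s' t' ∧ s = s'.inst σ ∧ t = t'.inst σ := by
  cases h with
  | semi_lt x y z =>
    exact ⟨_, _, Asg.triple x y z, .semi_lt, by simp [Seq.inst, Str.inst, Asg.triple]⟩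
  | lt_semi x y z =>
    exact ⟨_, _, Asg.triple x y z, .lt_semi, by simp [Seq.inst, Str.inst, Asg.triple]⟩
  | semi_gt x y z =>
    exact ⟨_, _, Asg.triple x y z, .semi_gt, by simp [Seq.inst, Str.inst, Asg.triple]⟩
  | gt_semi x y z =>
    exact ⟨_, _, Asg.triple x y z, .gt_semi, by simp [Seq.inst, Str.inst, Asg.triple]⟩
  | tri_arr s i x y z =>
    exact ⟨_, _, Asg.triple x y z, .tri_arr s i, by simp [Seq.inst, Str.inst, Asg.triple]⟩
  | tri_lar s i x y z =>
    exact ⟨_, _, Asg.triple x y z, .tri_lar s i, by simp [Seq.inst, Str.inst, Asg.triple]⟩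

theorem displayStep_iff {s t : Seq (Term P F A)} :
    (dynamicCalculus P F A classical).DisplayStep s t ↔ Disp s t ∨ Disp t s := by
  constructor
  · rintro ⟨r, ⟨s', t', h, rfl⟩, σ, hs, rfl⟩
    simp only [List.map_cons, List.map_nil, List.cons.injEq, and_true] at hs
    subst hs
    exact h.imp (fun h => h.disp σ) (fun h => h.disp σ)
  · rintro (h | h)
    · obtain ⟨s', t', σ, h', rfl, rfl⟩ := h.exists_dispPair
      exact ⟨_, ⟨s', t', Or.inl h', rfl⟩, σ, rfl, rfl⟩
    · obtain ⟨s', t', σ, h', rfl, rfl⟩ := h.exists_dispPair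
      exact ⟨_, ⟨t', s', Or.inr h', rfl⟩, σ, rfl, rfl⟩

theorem Shade.flip_flip (s : Shade) : s.flip.flip = s := by cases s <;> rfl

/-- The postulates are indexed by the colour of the triangle; this form is indexed by that of the
arrow. -/
theorem Disp.tri_arr_flip {S T U : Ty} (s : Shade) (i : Fam S T U) (x : Str (Term P F A) S)
    (y : Str (Term P F A) T) (z : Str (Term P F A) U) :
    Disp (tri s.flip i x y ⊢ₛ z) (y ⊢ₛ arr s i x z) := by
  simpa [Shade.flip_flip] using Disp.tri_arr s.flip i x y z

theorem Disp.tri_lar_flip {S T U : Ty} (s : Shade) (i : Fam S T U) (x : Str (Term P F A) S)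
    (y : Str (Term P F A) T) (z : Str (Term P F A) U) :
    Disp (tri s.flip i x y ⊢ₛ z) (x ⊢ₛ lar s i z y) := by
  simpa [Shade.flip_flip] using Disp.tri_lar s.flip i x y z

theorem Disp.displayEquiv {s t : Seq (Term P F A)} (h : Disp s t) :
    (dynamicCalculus P F A classical).DisplayEquiv s t :=
  ⟨.single (displayStep_iff.2 (Or.inl h)), .single (displayStep_iff.2 (Or.inr h))⟩

theorem Calculus.DisplayEquiv.symm {C : Calculus P F A} {s t : Seq (Term P F A)}
    (h : C.DisplayEquiv s t) : C.DisplayEquiv t s := ⟨h.2, h.1⟩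

theorem Calculus.DisplayEquiv.trans {C : Calculus P F A} {s t w : Seq (Term P F A)}
    (h : C.DisplayEquiv s t) (h' : C.DisplayEquiv t w) : C.DisplayEquiv s w :=
  ⟨h.1.trans h'.1, h'.2.trans h.2⟩

theorem Calculus.DisplayEquiv.exists_displays {C : Calculus P F A} {s t : Seq (Term P F A)}
    (h : C.DisplayEquiv s t) {b b' : Bool} {z : Σ S : Ty, Str (Term P F A) S} (hb : b = b')
    (ht : ∃ w, C.DisplayEquiv t w ∧ w.Displays b z) :
    ∃ w, C.DisplayEquiv s w ∧ w.Displays b' z := by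
  obtain ⟨w, h₁, h₂⟩ := ht
  exact ⟨w, h.trans h₁, hb ▸ h₂⟩

/-- By induction on the path: one or two postulates bring the immediate constituent on the path into
display, and the connectives for which there is no postulate are exactly the severe ones excluded by
`ClearAt`. -/
theorem exists_displays (classical : Prop) {T : Ty} (x y : Str (Term P F A) T) (p : List Side)
    (z : Σ S : Ty, Str (Term P F A) S) :
    (x.subAt p = some z → x.ClearAt true p →
      ∃ t, (dynamicCalculus P F A classical).DisplayEquiv (x ⊢ₛ y) t ∧
        t.Displays (!(x.negAt p)) z) ∧
    (y.subAt p = some z → y.ClearAt false p →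
      ∃ t, (dynamicCalculus P F A classical).DisplayEquiv (x ⊢ₛ y) t ∧
        t.Displays (y.negAt p) z) := by
  induction p generalizing T with
  | nil =>
    refine ⟨fun h _ => ⟨_, ⟨.refl, .refl⟩, ?_⟩, fun h _ => ⟨_, ⟨.refl, .refl⟩, ?_⟩⟩
    · simpa [Seq.Displays] using h
    · simpa [Seq.Displays] using h
  | cons d p ih =>
    constructor
    · intro h hc
      cases x with
      | leaf a => simp at h
      | unit => simp at h
      | node c x₁ x₂ =>
        cases d <;> obtain ⟨hs, hc⟩ := hc
        · cases c with
          | semi =>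
            exact (Disp.semi_lt x₁ x₂ y).displayEquiv.exists_displays (by simp [Conn.neg₁])
              ((ih _ _).1 h hc)
          | gt =>
            -- An antitone coordinate takes two postulates: `x₁ ≻ x₂ ⊢ y` becomes `x₂ ⊢ x₁ ⨾ y` and
            -- then `x₂ ≺ y ⊢ x₁`. The other antitone cases pass through `⨾` or a triangle in the
            -- same way.
            exact ((Disp.gt_semi x₁ y x₂).displayEquiv.symm.trans
              (Disp.lt_semi x₁ y x₂).displayEquiv).exists_displays (by simp [Conn.neg₁])
              ((ih _ _).2 h hc)
          | lt =>
            exact (Disp.lt_semi y x₂ x₁).displayEquiv.symm.exists_displays (by simp [Conn.neg₁])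
              ((ih _ _).1 h hc)
          | tri s i =>
            exact (Disp.tri_lar s i x₁ x₂ y).displayEquiv.exists_displays (by simp [Conn.neg₁])
              ((ih _ _).1 h hc)
          | arr s i => exact (hs rfl).elim
          | lar s i => exact (hs rfl).elim
        · cases c with
          | semi =>
            exact (Disp.semi_gt x₁ x₂ y).displayEquiv.exists_displays (by simp [Conn.neg₂])
              ((ih _ _).1 h hc)
          | gt =>
            exact (Disp.gt_semi x₁ y x₂).displayEquiv.symm.exists_displays (by simp [Conn.neg₂])
              ((ih _ _).1 h hc)
          | lt =>
            exact ((Disp.lt_semi y x₂ x₁).displayEquiv.symm.trans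
              (Disp.gt_semi y x₂ x₁).displayEquiv).exists_displays (by simp [Conn.neg₂])
              ((ih _ _).2 h hc)
          | tri s i =>
            exact (Disp.tri_arr s i x₁ x₂ y).displayEquiv.exists_displays (by simp [Conn.neg₂])
              ((ih _ _).1 h hc)
          | arr s i => exact (hs rfl).elim
          | lar s i => exact (hs rfl).elim
    · intro h hc
      cases y with
      | leaf a => simp at h
      | unit => simp at h
      | node c y₁ y₂ =>
        cases d <;> obtain ⟨hs, hc⟩ := hc
        · cases c with
          | semi =>
            exact (Disp.lt_semi y₁ y₂ x).displayEquiv.exists_displays (by simp [Conn.neg₁])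
              ((ih _ _).2 h hc)
          | gt =>
            exact ((Disp.semi_gt y₁ x y₂).displayEquiv.symm.trans
              (Disp.semi_lt y₁ x y₂).displayEquiv).exists_displays (by simp [Conn.neg₁])
              ((ih _ _).1 h hc)
          | lt =>
            exact (Disp.semi_lt x y₂ y₁).displayEquiv.symm.exists_displays (by simp [Conn.neg₁])
              ((ih _ _).2 h hc)
          | tri s i => exact (hs rfl).elim
          | arr s i =>
            exact ((Disp.tri_arr_flip s i y₁ x y₂).displayEquiv.symm.trans
              (Disp.tri_lar _ i y₁ x y₂).displayEquiv).exists_displays (by simp [Conn.neg₁])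
              ((ih _ _).1 h hc)
          | lar s i =>
            exact (Disp.tri_lar_flip s i x y₂ y₁).displayEquiv.symm.exists_displays
              (by simp [Conn.neg₁]) ((ih _ _).2 h hc)
        · cases c with
          | semi =>
            exact (Disp.gt_semi y₁ y₂ x).displayEquiv.exists_displays (by simp [Conn.neg₂])
              ((ih _ _).2 h hc)
          | gt =>
            exact (Disp.semi_gt y₁ x y₂).displayEquiv.symm.exists_displays (by simp [Conn.neg₂])
              ((ih _ _).2 h hc)
          | lt =>
            exact ((Disp.semi_lt x y₂ y₁).displayEquiv.symm.trans
              (Disp.semi_gt x y₂ y₁).displayEquiv).exists_displays (by simp [Conn.neg₂])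
              ((ih _ _).1 h hc)
          | tri s i => exact (hs rfl).elim
          | arr s i =>
            exact (Disp.tri_arr_flip s i y₁ x y₂).displayEquiv.symm.exists_displays
              (by simp [Conn.neg₂]) ((ih _ _).2 h hc)
          | lar s i =>
            exact ((Disp.tri_lar_flip s i x y₂ y₁).displayEquiv.symm.trans
              (Disp.tri_arr _ i x y₂ y₁).displayEquiv).exists_displays (by simp [Conn.neg₂])
              ((ih _ _).1 h hc)

theorem displayProperty : (dynamicCalculus P F A classical).DisplayProperty := by
  intro s hs d p z h hc
  have := typeUniform_of_derivable hs
  obtain ⟨x, y⟩ := s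
  cases this
  cases d
  · exact (exists_displays classical x y p z).1 h hc
  · exact (exists_displays classical x y p z).2 h hc

/-- Triangles have no values in `ag` or `fnc`, display postulates leading to these types put an
`arr` or `lar` on the right, and operational rules introduce only formulas and actions of type
`act`. Only the identity axioms remain. -/
theorem RuleKind.eq_of_inst_eq {r : Rule P F A} (h : RuleKind classical r) (σ : Asg P F A)
    (hu : ∀ q ∈ r.prems, q.lt = q.rt) {T : Ty} (hT : T = .ag ∨ T = .fnc)
    {x : Str (Term P F A) T} {a : Term P F A T} (e : r.concl.inst σ = (x ⊢ₛ .leaf a)) :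
    x = .leaf a := by
  rcases h with (h | h) | (h | h) | h | h | h
  case op =>
    cases h
    case triL s i a b =>
      -- Uniformity of the premise ties the open type of the right side in `triL` to the value type
      -- of a triangle, which is `act` or `fm`.
      have h₁ := hu _ (List.mem_singleton.2 rfl)
      have h₂ := congrArg Seq.rt e
      cases h₁.trans h₂
      rcases hT with rfl | rfl <;> cases i
    case triR s i a b =>
      cases congrArg Seq.rt e
      rcases hT with rfl | rfl <;> cases i
    all_goals rcases hT with rfl | rfl <;> simp [Seq.inst, Str.inst] at e
  all_goals
    rcases hT with rfl | rfl <;> cases h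
  all_goals try (rename_i i; cases i)
  all_goals first | (simp [Seq.inst, Str.inst] at e; done) | (cases e; rfl)

/-- By induction on the derivation, cuts included: both premises of a cut with this conclusion again
have a leaf of type `T` on the right, so both collapse to identities. -/
theorem eq_leaf_of_derivable {T : Ty} (hT : T = .ag ∨ T = .fnc) {x : Str (Term P F A) T}
    {a : Term P F A T} (h : (dynamicCalculus P F A classical).Derivable (x ⊢ₛ .leaf a)) :
    x = .leaf a := by
  generalize e : (x ⊢ₛ .leaf a : Seq (Term P F A)) = s at h
  unfold Calculus.Derivable at h
  induction h generalizing x a with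
  | hyp h => exact h.elim
  | @app r σ hr _ hp ih =>
    rcases hr with hr | ⟨S, b, rfl⟩
    · exact (mem_rules_iff.1 hr).eq_of_inst_eq σ
        (fun q hq => typeUniform_of_derivable (hp q hq)) hT e.symm
    · obtain rfl : T = S := congrArg Seq.lt e
      have h₁ : σ T 0 = .leaf b := ih ((v 0 : Str _ T) ⊢ₛ o b) (by simp [cutRule]) rfl
      simp only [cutRule, Seq.inst, Str.inst, Seq.mk.injEq, heq_eq_eq, true_and] at e
      have h₂ : Str.leaf b = .leaf a := ih (o b ⊢ₛ (v 1 : Str _ T)) (by simp [cutRule])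
        (by simp [Seq.inst, Str.inst, e.2])
      rw [e.1, h₁, h₂]

theorem trivialCuts {T : Ty} (hT : T = .ag ∨ T = .fnc) :
    (dynamicCalculus P F A classical).TrivialCuts T :=
  fun _ _ _ h _ => Or.inl (eq_leaf_of_derivable hT h)

end Display

/-! ### Instances of the axioms: chains, display-invariance, closure under cut. -/

section Axioms

variable {P F A : Type u} {classical : Prop}

/-- `PreChain b x`: the structure `x` is `F₁ ∘ (F₂ ∘ ⋯ (Fₙ ∘ b))` with `∘ ∈ {△₀, ▲₀}`. -/
inductive PreChain (b : Str (Term P F A) .fm) : Str (Term P F A) .fm → Prop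
  | base : PreChain b b
  | step (s : Shade) (f : Str (Term P F A) .fnc) {x : Str (Term P F A) .fm} :
      PreChain b x → PreChain b (tri s .i0 f x)

/-- `SucChain b y`: the structure `y` is `G₁ ⊳ (G₂ ⊳ ⋯ (Gₘ ⊳ b))` with `⊳ ∈ {▷₀, ▶₀}`. -/
inductive SucChain (b : Str (Term P F A) .fm) : Str (Term P F A) .fm → Prop
  | base : SucChain b b
  | step (s : Shade) (f : Str (Term P F A) .fnc) {y : Str (Term P F A) .fm} :
      SucChain b y → SucChain b (arr s .i0 f y)

/-- The instances of the axioms. -/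
inductive AxInst : Seq (Term P F A) → Prop
  | agt (a : A) : AxInst (Str.leaf (Term.agt a) ⊢ₛ .leaf (.agt a))
  | fnc (f : F) : AxInst (Str.leaf (Term.fnc f) ⊢ₛ .leaf (.fnc f))
  | bot : AxInst (.leaf .bot ⊢ₛ .unit)
  | top : AxInst (.unit ⊢ₛ .leaf .top)
  | atom (p : P) {x y : Str (Term P F A) .fm} : PreChain (.leaf (.prop p)) x →
      SucChain (.leaf (.prop p)) y → AxInst (x ⊢ₛ y)

theorem preChain_inst_atomL (σ : Asg P F A) (p : P) (k : ℕ) (l : List Shade) :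
    PreChain (.leaf (.prop p)) ((atomL p k l).inst σ) := by
  induction l generalizing k with
  | nil => exact .base
  | cons s l ih => exact .step s _ (ih (k + 1))

theorem sucChain_inst_atomR (σ : Asg P F A) (p : P) (k : ℕ) (l : List Shade) :
    SucChain (.leaf (.prop p)) ((atomR p k l).inst σ) := by
  induction l generalizing k with
  | nil => exact .base
  | cons s l ih => exact .step s _ (ih (k + 1))

/-- The offset `k` is left free and `σ` is constrained only on the numbers in use, so that the two
chains of an atom axiom can share one assignment. -/
theorem PreChain.exists_atomL {p : P} {x : Str (Term P F A) .fm}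
    (h : PreChain (.leaf (.prop p)) x) :
    ∃ (l : List Shade) (τ : ℕ → Str (Term P F A) .fnc), ∀ (k : ℕ) (σ : Asg P F A),
      (∀ j < l.length, σ .fnc (k + j) = τ j) → (atomL p k l).inst σ = x := by
  induction h with
  | base => exact ⟨[], fun _ => .default _, fun _ _ _ => rfl⟩
  | step s f _ ih =>
    obtain ⟨l, τ, h⟩ := ih
    refine ⟨s :: l, fun j => j.casesOn f τ, fun k σ hσ => ?_⟩
    have h₁ := hσ 0 (by simp)
    have h₂ := h (k + 1) σ fun j hj => by
      simpa [Nat.add_comm, Nat.add_left_comm] using hσ (j + 1) (by simpa using hj)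
    simp only [atomL, Str.inst, h₂]
    rw [show σ .fnc k = f from h₁]

theorem SucChain.exists_atomR {p : P} {x : Str (Term P F A) .fm}
    (h : SucChain (.leaf (.prop p)) x) :
    ∃ (l : List Shade) (τ : ℕ → Str (Term P F A) .fnc), ∀ (k : ℕ) (σ : Asg P F A),
      (∀ j < l.length, σ .fnc (k + j) = τ j) → (atomR p k l).inst σ = x := by
  induction h with
  | base => exact ⟨[], fun _ => .default _, fun _ _ _ => rfl⟩
  | step s f _ ih =>
    obtain ⟨l, τ, h⟩ := ih
    refine ⟨s :: l, fun j => j.casesOn f τ, fun k σ hσ => ?_⟩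
    have h₁ := hσ 0 (by simp)
    have h₂ := h (k + 1) σ fun j hj => by
      simpa [Nat.add_comm, Nat.add_left_comm] using hσ (j + 1) (by simpa using hj)
    simp only [atomR, Str.inst, h₂]
    rw [show σ .fnc k = f from h₁]

theorem Ax.axInst {s : Seq (Sch P F A)} (h : Ax s) (σ : Asg P F A) : AxInst (s.inst σ) := by
  cases h with
  | agt a => exact .agt a
  | fnc f => exact .fnc f
  | prop p => exact .atom p .base .base
  | botL => exact .bot
  | topR => exact .top
  | atom p l m => exact .atom p (preChain_inst_atomL σ p _ _) (sucChain_inst_atomR σ p _ _)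

theorem AxInst.exists_ax {s : Seq (Term P F A)} (h : AxInst s) :
    ∃ s' : Seq (Sch P F A), ∃ σ, Ax s' ∧ s = s'.inst σ := by
  cases h with
  | agt a => exact ⟨_, fun T _ => .default T, .agt a, rfl⟩
  | fnc f => exact ⟨_, fun T _ => .default T, .fnc f, rfl⟩
  | bot => exact ⟨_, fun T _ => .default T, .botL, rfl⟩
  | top => exact ⟨_, fun T _ => .default T, .topR, rfl⟩
  | atom p hx hy =>
    obtain ⟨l, τ, hl⟩ := hx.exists_atomL
    obtain ⟨m, τ', hm⟩ := hy.exists_atomR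
    -- Numbers below `l.length` serve the left chain and the later ones the right chain, as in the
    -- schema `Ax.atom`; the values at types other than `fnc` are irrelevant defaults.
    refine ⟨_, fun T n => (if n < l.length then τ n else τ' (n - l.length)).castTo T,
      .atom p l m, ?_⟩
    rw [Seq.inst, hl, hm]
    · intro j _
      simp
    · intro j hj
      simp [hj]

theorem RuleKind.ax_of_prems_eq_nil {r : Rule P F A} (h : RuleKind classical r)
    (hr : r.prems = []) : Ax r.concl := by
  rcases h with h | h | h | h | h
  · cases hr
  · cases hr
  · cases hr
  · exact h
  · cases h <;> cases hr

theorem isAxiom_iff {s : Seq (Term P F A)} :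
    (dynamicCalculus P F A classical).IsAxiom s ↔ AxInst s := by
  constructor
  · rintro ⟨r, hr, σ, h, rfl⟩
    exact ((mem_rules_iff.1 hr).ax_of_prems_eq_nil h).axInst σ
  · intro h
    obtain ⟨s', σ, h', rfl⟩ := h.exists_ax
    exact ⟨⟨[], s'⟩, mem_rules_iff.2 (.ax h'), σ, rfl, rfl⟩

/-- No side of an axiom has `⨾`, `≻`, `≺` or `lar` outermost, so only the triangle postulates apply.
`tri_arr` moves a link from the left chain to the right one; `tri_lar` displays a functional action
and so changes the type, which the hypotheses forbid. -/
theorem AxInst.of_disp {s t : Seq (Term P F A)} (h : AxInst s) (hd : Disp s t)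
    {T : Ty} (hs : s.OfType T) (ht : t.OfType T) : AxInst t := by
  cases hd with
  | semi_lt x y z => cases h with | atom p hx hy => cases hx
  | lt_semi x y z => cases h with | atom p hx hy => cases hy
  | semi_gt x y z => cases h with | atom p hx hy => cases hx
  | gt_semi x y z => cases h with | atom p hx hy => cases hy
  | tri_arr s i x y z =>
    cases h with | atom p hx hy => cases hx with | step _ _ hx => exact .atom p hx (.step _ _ hy)
  | tri_lar s i x y z =>
    cases h with | atom p hx hy => cases hx with | step _ _ hx => cases hs.1.trans ht.1.symm

theorem AxInst.of_disp_symm {s t : Seq (Term P F A)} (h : AxInst s) (hd : Disp t s) :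
    AxInst t := by
  cases hd with
  | semi_lt x y z => cases h with | atom p hx hy => cases hy
  | lt_semi x y z => cases h with | atom p hx hy => cases hx
  | semi_gt x y z => cases h with | atom p hx hy => cases hy
  | gt_semi x y z => cases h with | atom p hx hy => cases hx
  | tri_arr s i x y z =>
    cases h with | atom p hx hy => cases hy with | step _ _ hy => exact .atom p (.step _ _ hx) hy
  | tri_lar s i x y z => cases h with | atom p hx hy => cases hy

/-- Each link moves to the right as an arrow of the other colour until the end of the chain stands
alone. The end `b` is arbitrary because in cut elimination the atom there is replaced by a
structure. -/
theorem PreChain.displayEquiv {b : Str (Term P F A) .fm} {x : Str (Term P F A) .fm}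
    (h : PreChain b x) {c y : Str (Term P F A) .fm} (hy : SucChain c y) :
    ∃ y', SucChain c y' ∧
      (dynamicCalculus P F A classical).DisplayEquiv (x ⊢ₛ y) (b ⊢ₛ y') := by
  induction h generalizing y with
  | base => exact ⟨y, hy, .refl, .refl⟩
  | step s f _ ih =>
    obtain ⟨y', h₁, h₂⟩ := ih (.step s.flip f hy)
    exact ⟨y', h₁, (Disp.tri_arr s .i0 f _ y).displayEquiv.trans h₂⟩

theorem SucChain.displayEquiv {b : Str (Term P F A) .fm} {y : Str (Term P F A) .fm}
    (h : SucChain b y) {c x : Str (Term P F A) .fm} (hx : PreChain c x) :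
    ∃ x', PreChain c x' ∧
      (dynamicCalculus P F A classical).DisplayEquiv (x ⊢ₛ y) (x' ⊢ₛ b) := by
  induction h generalizing x with
  | base => exact ⟨x, hx, .refl, .refl⟩
  | step s f _ ih =>
    obtain ⟨x', h₁, h₂⟩ := ih (.step s.flip f hx)
    exact ⟨x', h₁, (Disp.tri_arr_flip s .i0 f x _).displayEquiv.symm.trans h₂⟩

/-- The functional actions of the schema are variables, so its only operational term is the atom,
reached through second coordinates of triangles, which are monotone. -/
theorem subAt_atomL (σ : Asg P F A) {p : P} {k : ℕ} {l : List Shade} {T : Ty} {a : Term P F A T}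
    {q : List Side} (h : (atomL p k l).subAt q = some ⟨T, .leaf (.term a)⟩) :
    (⟨T, a⟩ : Σ T : Ty, Term P F A T) = ⟨.fm, .prop p⟩ ∧
      ((atomL p k l).inst σ).negAt q = false := by
  induction l generalizing k q with
  | nil =>
    cases q with
    | nil => cases h; exact ⟨rfl, rfl⟩
    | cons d q => simp [atomL] at h
  | cons s l ih =>
    cases q with
    | nil => cases h
    | cons d q =>
      cases d
      · cases q with
        | nil => cases h
        | cons d q => simp [atomL] at h
      · simpa [atomL, Str.inst, Conn.neg₂] using ih (k := k + 1) (by simpa [atomL] using h)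

theorem subAt_atomR (σ : Asg P F A) {p : P} {k : ℕ} {l : List Shade} {T : Ty} {a : Term P F A T}
    {q : List Side} (h : (atomR p k l).subAt q = some ⟨T, .leaf (.term a)⟩) :
    (⟨T, a⟩ : Σ T : Ty, Term P F A T) = ⟨.fm, .prop p⟩ ∧
      ((atomR p k l).inst σ).negAt q = false := by
  induction l generalizing k q with
  | nil =>
    cases q with
    | nil => cases h; exact ⟨rfl, rfl⟩
    | cons d q => simp [atomR] at h
  | cons s l ih =>
    cases q with
    | nil => cases h
    | cons d q =>
      cases d
      · cases q with
        | nil => cases h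
        | cons d q => simp [atomR] at h
      · simpa [atomR, Str.inst, Conn.neg₂] using ih (k := k + 1) (by simpa [atomR] using h)

theorem Seq.displays_of_subAt_nil {s : Seq (Term P F A)} {d : Side}
    {z : Σ S : Ty, Str (Term P F A) S} (h : s.subAt d [] = some z) :
    s.Displays (s.antAt d []) z := by
  cases d <;> simpa [Seq.Displays, Seq.antAt, Seq.subAt] using h

theorem Ax.exists_displays {s : Seq (Sch P F A)} (h : Ax s) {T : Ty} {a : Term P F A T}
    {d : Side} {p : List Side} (ha : s.subAt d p = some ⟨T, .leaf (.term a)⟩) (σ : Asg P F A) :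
    ∃ t, AxInst t ∧ (dynamicCalculus P F A classical).DisplayEquiv (s.inst σ) t ∧
      t.Displays ((s.inst σ).antAt d p) ⟨T, .leaf a⟩ := by
  have key : s.l.TopTerms → s.r.TopTerms → ∃ t, AxInst t ∧
      (dynamicCalculus P F A classical).DisplayEquiv (s.inst σ) t ∧
      t.Displays ((s.inst σ).antAt d p) ⟨T, .leaf a⟩ := by
    intro hl hr
    obtain rfl : p = [] := by
      cases d
      · exact hl.path_eq_nil ha
      · exact hr.path_eq_nil ha
    refine ⟨_, h.axInst σ, ⟨.refl, .refl⟩, Seq.displays_of_subAt_nil ?_⟩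
    cases d
    · exact s.l.subAt_inst_term σ a [] ha
    · exact s.r.subAt_inst_term σ a [] ha
  cases h with
  | agt a => exact key (.inr ⟨_, rfl⟩) (.inr ⟨_, rfl⟩)
  | fnc a => exact key (.inr ⟨_, rfl⟩) (.inr ⟨_, rfl⟩)
  | prop a => exact key (.inr ⟨_, rfl⟩) (.inr ⟨_, rfl⟩)
  | botL => exact key (.inr ⟨_, rfl⟩) (.inl rfl)
  | topR => exact key (.inl rfl) (.inr ⟨_, rfl⟩)
  | atom p l m =>
    have hx := preChain_inst_atomL σ p 0 l
    have hy := sucChain_inst_atomR σ p l.length m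
    cases d
    · obtain ⟨e, hn⟩ := subAt_atomL σ ha
      cases e
      obtain ⟨y', h₁, h₂⟩ := hx.displayEquiv (classical := classical) hy
      exact ⟨_, .atom p .base h₁, h₂, by simp [Seq.antAt, Seq.inst, hn, Seq.Displays]⟩
    · obtain ⟨e, hn⟩ := subAt_atomR σ ha
      cases e
      obtain ⟨x', h₁, h₂⟩ := hy.displayEquiv (classical := classical) hx
      exact ⟨_, .atom p h₁ .base, h₂, by simp [Seq.antAt, Seq.inst, hn, Seq.Displays]⟩

theorem axioms_displayInvariant : (dynamicCalculus P F A classical).C5'' := by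
  refine ⟨fun s t T hs hst hsT htT => ?_, fun r hr hp T a d p ha σ => ?_⟩
  · rw [isAxiom_iff] at hs ⊢
    rcases displayStep_iff.1 hst with h | h
    · exact hs.of_disp h hsT htT
    · exact hs.of_disp_symm h
  · simp only [isAxiom_iff]
    exact ((mem_rules_iff.1 hr).ax_of_prems_eq_nil hp).exists_displays ha σ

/-- When the cut term is an atom, the chains facing the cut are bare, and the two outer chains form
an atom axiom. No axiom has `⊥` alone on the right or `⊤` alone on the left. -/
theorem AxInst.cut {S T U : Ty} {x : Str (Term P F A) S} {a : Term P F A T}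
    {y : Str (Term P F A) U} (h₁ : AxInst (x ⊢ₛ .leaf a)) (h₂ : AxInst (.leaf a ⊢ₛ y)) :
    AxInst (x ⊢ₛ y) := by
  cases h₁ with
  | agt a => exact h₂
  | fnc f => exact h₂
  | top => cases h₂ with | atom p hx hy => cases hx
  | atom p hx hy =>
    cases hy
    cases h₂ with
    | atom p hx' hy' =>
      cases hx'
      exact .atom _ hx hy'

theorem axioms_closed_cut : (dynamicCalculus P F A classical).C8'' := by
  intro S T U x a y h₁ h₂
  rw [isAxiom_iff] at *
  exact h₁.cut h₂

end Axioms

/-! ### Introductions of principal terms, and principal cuts. -/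

section Principal

variable {P F A : Type u} {classical : Prop}

/-- `RightIntro l x a`: an application of a rule with premises `l` and conclusion `x ⊢ a` in
which `a` is principal. -/
inductive RightIntro : List (Seq (Term P F A)) → {T : Ty} → Str (Term P F A) T →
    Term P F A T → Prop
  | prop (p : P) {x : Str (Term P F A) .fm} :
      PreChain (.leaf (.prop p)) x → RightIntro [] x (.prop p)
  | agt (a : A) : RightIntro [] (.leaf (.agt a)) (.agt a)
  | fnc (f : F) : RightIntro [] (.leaf (.fnc f)) (.fnc f)
  | top : RightIntro [] .unit .top
  | bot (x : Str (Term P F A) .fm) : RightIntro [x ⊢ₛ .unit] x .bot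
  | and (x y : Str (Term P F A) .fm) (a b : Term P F A .fm) :
      RightIntro [x ⊢ₛ .leaf a, y ⊢ₛ .leaf b] (x ⨾ y) (.node .and a b)
  | or (x : Str (Term P F A) .fm) (a b : Term P F A .fm) :
      RightIntro [x ⊢ₛ .leaf a ⨾ .leaf b] x (.node .or a b)
  | limp (x : Str (Term P F A) .fm) (b a : Term P F A .fm) :
      RightIntro [x ⊢ₛ .leaf b ≺ .leaf a] x (.node .limp b a)
  | lexcl (x y : Str (Term P F A) .fm) (b a : Term P F A .fm) :
      RightIntro [x ⊢ₛ .leaf b, .leaf a ⊢ₛ y] (x ≺ y) (.node .lexcl b a)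
  | imp (x : Str (Term P F A) .fm) (a b : Term P F A .fm) :
      RightIntro [x ⊢ₛ .leaf a ≻ .leaf b] x (.node .imp a b)
  | excl (x y : Str (Term P F A) .fm) (a b : Term P F A .fm) :
      RightIntro [.leaf a ⊢ₛ x, y ⊢ₛ .leaf b] (x ≻ y) (.node .excl a b)
  | tri {S T U : Ty} (s : Shade) (i : Fam S T U) (x : Str (Term P F A) S)
      (y : Str (Term P F A) T) (a : Term P F A S) (b : Term P F A T) :
      RightIntro [x ⊢ₛ .leaf a, y ⊢ₛ .leaf b] (tri s i x y) (.node (.tri s i) a b)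
  | arr {S : Ty} (s : Shade) (i : Fam S .fm .fm) (x : Str (Term P F A) .fm)
      (a : Term P F A S) (b : Term P F A .fm) :
      RightIntro [x ⊢ₛ arr s i (.leaf a) (.leaf b)] x (.node (.arr s i) a b)

/-- `LeftIntro l a y`: an application of a rule with premises `l` and conclusion `a ⊢ y` in
which `a` is principal. -/
inductive LeftIntro : List (Seq (Term P F A)) → {T : Ty} → Term P F A T →
    Str (Term P F A) T → Prop
  | prop (p : P) {y : Str (Term P F A) .fm} :
      SucChain (.leaf (.prop p)) y → LeftIntro [] (.prop p) y
  | agt (a : A) : LeftIntro [] (.agt a) (.leaf (.agt a))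
  | fnc (f : F) : LeftIntro [] (.fnc f) (.leaf (.fnc f))
  | bot : LeftIntro [] .bot .unit
  | top (y : Str (Term P F A) .fm) : LeftIntro [.unit ⊢ₛ y] .top y
  | and (a b : Term P F A .fm) (y : Str (Term P F A) .fm) :
      LeftIntro [.leaf a ⨾ .leaf b ⊢ₛ y] (.node .and a b) y
  | or (a b : Term P F A .fm) (x y : Str (Term P F A) .fm) :
      LeftIntro [.leaf a ⊢ₛ x, .leaf b ⊢ₛ y] (.node .or a b) (x ⨾ y)
  | limp (b a : Term P F A .fm) (x y : Str (Term P F A) .fm) :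
      LeftIntro [.leaf b ⊢ₛ x, y ⊢ₛ .leaf a] (.node .limp b a) (x ≺ y)
  | lexcl (b a : Term P F A .fm) (y : Str (Term P F A) .fm) :
      LeftIntro [.leaf b ≺ .leaf a ⊢ₛ y] (.node .lexcl b a) y
  | imp (a b : Term P F A .fm) (x y : Str (Term P F A) .fm) :
      LeftIntro [x ⊢ₛ .leaf a, .leaf b ⊢ₛ y] (.node .imp a b) (x ≻ y)
  | excl (a b : Term P F A .fm) (y : Str (Term P F A) .fm) :
      LeftIntro [.leaf a ≻ .leaf b ⊢ₛ y] (.node .excl a b) y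
  | tri {S T U : Ty} (s : Shade) (i : Fam S T U) (a : Term P F A S) (b : Term P F A T)
      (y : Str (Term P F A) U) :
      LeftIntro [tri s i (.leaf a) (.leaf b) ⊢ₛ y] (.node (.tri s i) a b) y
  | arr {S : Ty} (s : Shade) (i : Fam S .fm .fm) (a : Term P F A S) (b : Term P F A .fm)
      (x : Str (Term P F A) S) (y : Str (Term P F A) .fm) :
      LeftIntro [x ⊢ₛ .leaf a, .leaf b ⊢ₛ y] (.node (.arr s i) a b) (arr s i x y)

/-- Display postulates and structural rules mention no operational terms, so they have no principal
ones. -/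
theorem RuleKind.ax_or_op {r : Rule P F A} (h : RuleKind classical r) {T : Ty}
    {a : Term P F A T} {d : Side} {p : List Side} (ha : r.Principal a d p) :
    (r.prems = [] ∧ Ax r.concl) ∨ OpRule r.prems r.concl := by
  have key : r.concl.terms ≠ [] := by
    intro h
    obtain ⟨h₁, h₂⟩ := List.append_eq_nil_iff.1 h
    cases d
    · have := r.concl.l.mem_terms a p ha
      simp [h₁] at this
    · have := r.concl.r.mem_terms a p ha
      simp [h₂] at this
  rcases h with (h | h) | (h | h) | h | h | h
  · exact (key h.terms_eq_nil.2).elim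
  · exact (key h.terms_eq_nil.1).elim
  · exact (key h.terms_eq_nil.2).elim
  · exact (key h.terms_eq_nil.1).elim
  · exact (key h.terms_eq_nil.2).elim
  · exact Or.inl ⟨rfl, h⟩
  · exact Or.inr h

/-- In an atom axiom the atom is in display on the right only if the right chain is empty; the left
chain survives as the parameter of `RightIntro.prop`. -/
theorem RuleKind.rightIntro {r : Rule P F A} (h : RuleKind classical r) {T : Ty}
    {a : Term P F A T} (ha : r.Principal a .right []) {σ : Asg P F A} {x : Str (Term P F A) T}
    (e : r.concl.inst σ = (x ⊢ₛ .leaf a)) : RightIntro (r.prems.map (Seq.inst σ)) x a := by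
  rcases h.ax_or_op ha with ⟨hp, h⟩ | h
  · obtain ⟨l, s⟩ := r
    subst hp
    cases h with
    | atom p l m =>
      cases m with
      | nil => cases ha; cases e; exact .prop p (preChain_inst_atomL σ p _ _)
      | cons s m => cases ha
    | prop p => cases ha; cases e; exact .prop p .base
    | _ => cases ha <;> cases e <;> constructor
  · obtain ⟨l, s⟩ := r
    cases h <;> cases ha <;> cases e <;> constructor

theorem RuleKind.leftIntro {r : Rule P F A} (h : RuleKind classical r) {T : Ty}
    {a : Term P F A T} (ha : r.Principal a .left []) {σ : Asg P F A} {y : Str (Term P F A) T}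
    (e : r.concl.inst σ = (.leaf a ⊢ₛ y)) : LeftIntro (r.prems.map (Seq.inst σ)) a y := by
  rcases h.ax_or_op ha with ⟨hp, h⟩ | h
  · obtain ⟨l, s⟩ := r
    subst hp
    cases h with
    | atom p l m =>
      cases l with
      | nil => cases ha; cases e; exact .prop p (sucChain_inst_atomR σ p _ _)
      | cons s m => cases ha
    | prop p => cases ha; cases e; exact .prop p .base
    | _ => cases ha <;> cases e <;> constructor
  · obtain ⟨l, s⟩ := r
    cases h <;> cases ha <;> cases e <;> constructor

/-- The principal step of cut elimination, for a set of sequents that contains the axioms and is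
closed under display postulates and under cuts on proper subterms of the cut term. -/
theorem RightIntro.cut {D : Seq (Term P F A) → Prop} (hax : ∀ s, AxInst s → D s)
    (hd : ∀ s t, Disp s t → (D s ↔ D t)) {l m : List (Seq (Term P F A))} {T : Ty}
    {x y : Str (Term P F A) T} {a : Term P F A T} (hr : RightIntro l x a) (hl : LeftIntro m a y)
    (hc : ∀ (S : Ty) (b : Term P F A S) (x y : Str (Term P F A) S), ProperSubterm b a →
      D (x ⊢ₛ .leaf b) → D (.leaf b ⊢ₛ y) → D (x ⊢ₛ y))
    (h₁ : ∀ q ∈ l, D q) (h₂ : ∀ q ∈ m, D q) : D (x ⊢ₛ y) := by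
  cases hr with
  -- Atom axioms with a bare `p` on the right and on the left compose to an atom axiom.
  | prop p hx => cases hl with | prop p hy => exact hax _ (.atom p hx hy)
  | agt a => cases hl; exact hax _ (.agt a)
  | fnc f => cases hl; exact hax _ (.fnc f)
  | top => cases hl; exact h₂ _ (by simp)
  | bot => cases hl; exact h₁ _ (by simp)
  | and x₁ x₂ a b =>
    cases hl
    have ca := fun u w => hc _ a u w (.left _ _ (.refl _))
    have cb := fun u w => hc _ b u w (.right _ _ (.refl _))
    simp only [List.mem_cons, List.not_mem_nil, or_false, forall_eq_or_imp, forall_eq] at h₁ h₂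
    -- The pattern of all compound cases: display one immediate subterm by residuation and cut on
    -- it, then display the other one and cut again.
    have k := (hd _ _ (.semi_lt _ _ _)).2 (ca _ _ h₁.1 ((hd _ _ (.semi_lt _ _ _)).1 h₂))
    exact (hd _ _ (.semi_gt _ _ _)).2 (cb _ _ h₁.2 ((hd _ _ (.semi_gt _ _ _)).1 k))
  | or x a b =>
    cases hl
    have ca := fun u w => hc _ a u w (.left _ _ (.refl _))
    have cb := fun u w => hc _ b u w (.right _ _ (.refl _))
    simp only [List.mem_cons, List.not_mem_nil, or_false, forall_eq_or_imp, forall_eq] at h₁ h₂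
    have k := (hd _ _ (.lt_semi _ _ _)).2 (ca _ _ ((hd _ _ (.lt_semi _ _ _)).1 h₁) h₂.1)
    exact (hd _ _ (.gt_semi _ _ _)).2 (cb _ _ ((hd _ _ (.gt_semi _ _ _)).1 k) h₂.2)
  | limp x b a =>
    cases hl
    have ca := fun u w => hc _ a u w (.right _ _ (.refl _))
    have cb := fun u w => hc _ b u w (.left _ _ (.refl _))
    simp only [List.mem_cons, List.not_mem_nil, or_false, forall_eq_or_imp, forall_eq] at h₁ h₂
    have k := (hd _ _ (.semi_gt _ _ _)).1 (cb _ _ ((hd _ _ (.semi_lt _ _ _)).2 h₁) h₂.1)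
    exact (hd _ _ (.semi_lt _ _ _)).1 ((hd _ _ (.semi_gt _ _ _)).2 (ca _ _ h₂.2 k))
  | lexcl x₁ x₂ b a =>
    cases hl
    have ca := fun u w => hc _ a u w (.right _ _ (.refl _))
    have cb := fun u w => hc _ b u w (.left _ _ (.refl _))
    simp only [List.mem_cons, List.not_mem_nil, or_false, forall_eq_or_imp, forall_eq] at h₁ h₂
    have k := (hd _ _ (.gt_semi _ _ _)).1 (cb _ _ h₁.1 ((hd _ _ (.lt_semi _ _ _)).2 h₂))
    exact (hd _ _ (.lt_semi _ _ _)).1 ((hd _ _ (.gt_semi _ _ _)).2 (ca _ _ k h₁.2))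
  | imp x a b =>
    cases hl
    have ca := fun u w => hc _ a u w (.left _ _ (.refl _))
    have cb := fun u w => hc _ b u w (.right _ _ (.refl _))
    simp only [List.mem_cons, List.not_mem_nil, or_false, forall_eq_or_imp, forall_eq] at h₁ h₂
    have k := (hd _ _ (.semi_lt _ _ _)).1 (cb _ _ ((hd _ _ (.semi_gt _ _ _)).2 h₁) h₂.2)
    exact (hd _ _ (.semi_gt _ _ _)).1 ((hd _ _ (.semi_lt _ _ _)).2 (ca _ _ h₂.1 k))
  | excl x₁ x₂ a b =>
    cases hl
    have ca := fun u w => hc _ a u w (.left _ _ (.refl _))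
    have cb := fun u w => hc _ b u w (.right _ _ (.refl _))
    simp only [List.mem_cons, List.not_mem_nil, or_false, forall_eq_or_imp, forall_eq] at h₁ h₂
    have k := (hd _ _ (.lt_semi _ _ _)).1 (cb _ _ h₁.2 ((hd _ _ (.gt_semi _ _ _)).2 h₂))
    exact (hd _ _ (.gt_semi _ _ _)).1 ((hd _ _ (.lt_semi _ _ _)).2 (ca _ _ k h₁.1))
  | tri s i x₁ x₂ a b =>
    cases hl
    have ca := fun u w => hc _ a u w (.left _ _ (.refl _))
    have cb := fun u w => hc _ b u w (.right _ _ (.refl _))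
    simp only [List.mem_cons, List.not_mem_nil, or_false, forall_eq_or_imp, forall_eq] at h₁ h₂
    have k := (hd _ _ (.tri_arr _ _ _ _ _)).2
      (cb _ _ h₁.2 ((hd _ _ (.tri_arr _ _ _ _ _)).1 h₂))
    exact (hd _ _ (.tri_lar _ _ _ _ _)).2 (ca _ _ h₁.1 ((hd _ _ (.tri_lar _ _ _ _ _)).1 k))
  | arr s i x a b =>
    cases hl
    have ca := fun u w => hc _ a u w (.left _ _ (.refl _))
    have cb := fun u w => hc _ b u w (.right _ _ (.refl _))
    simp only [List.mem_cons, List.not_mem_nil, or_false, forall_eq_or_imp, forall_eq] at h₁ h₂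
    -- From `x` below the arrow one passes to the triangle of the other colour on `a` and `x`, and
    -- cuts on `b`; then `lar`, a virtual adjoint for `i = 0` and `i = 2`, displays `a`.
    have k := (hd _ _ (.tri_lar_flip _ _ _ _ _)).1
      (cb _ _ ((hd _ _ (.tri_arr_flip _ _ _ _ _)).2 h₁) h₂.2)
    exact (hd _ _ (.tri_arr_flip _ _ _ _ _)).1
      ((hd _ _ (.tri_lar_flip _ _ _ _ _)).2 (ca _ _ h₂.1 k))

theorem Derives.of_displayStep {R : Set (Rule P F A)} {H : Set (Seq (Term P F A))}
    (hR : (dynamicCalculus P F A classical).rules ⊆ R) {s t : Seq (Term P F A)}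
    (hst : (dynamicCalculus P F A classical).DisplayStep s t) (h : Derives R Set.univ H s) :
    Derives R Set.univ H t := by
  obtain ⟨r, hr, σ, hs, rfl⟩ := hst
  refine .app σ (hR ((dynamicCalculus P F A classical).display_subset hr)) trivial
    fun q hq => ?_
  have : q.inst σ ∈ r.prems.map (Seq.inst σ) := List.mem_map_of_mem hq
  rw [hs, List.mem_singleton] at this
  rwa [this]

theorem Derives.disp_iff {R : Set (Rule P F A)} {H : Set (Seq (Term P F A))}
    (hR : (dynamicCalculus P F A classical).rules ⊆ R) {s t : Seq (Term P F A)}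
    (hst : Disp s t) : Derives R Set.univ H s ↔ Derives R Set.univ H t :=
  ⟨.of_displayStep hR (displayStep_iff.2 (Or.inl hst)),
    .of_displayStep hR (displayStep_iff.2 (Or.inr hst))⟩

theorem Derives.of_displayEquiv {R : Set (Rule P F A)} {H : Set (Seq (Term P F A))}
    (hR : (dynamicCalculus P F A classical).rules ⊆ R) {s t : Seq (Term P F A)}
    (hst : (dynamicCalculus P F A classical).DisplayEquiv s t) (h : Derives R Set.univ H s) :
    Derives R Set.univ H t := by
  obtain ⟨hst, -⟩ := hst
  induction hst with
  | refl => exact h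
  | tail _ h' ih => exact ih.of_displayStep hR h'

theorem AxInst.derives {R : Set (Rule P F A)} {H : Set (Seq (Term P F A))}
    (hR : (dynamicCalculus P F A classical).rules ⊆ R) {s : Seq (Term P F A)}
    (h : AxInst s) : Derives R Set.univ H s := by
  obtain ⟨s', σ, h', rfl⟩ := h.exists_ax
  exact .app (r := ⟨[], s'⟩) σ (hR (mem_rules_iff.2 (.ax h'))) trivial
    fun _ hq => (List.not_mem_nil hq).elim

theorem Derives.cut {R : Set (Rule P F A)} {H : Set (Seq (Term P F A))} {T : Ty}
    {a : Term P F A T} (ha : cutRule a ∈ R) {x y : Str (Term P F A) T}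
    (h₁ : Derives R Set.univ H (x ⊢ₛ .leaf a)) (h₂ : Derives R Set.univ H (.leaf a ⊢ₛ y)) :
    Derives R Set.univ H (x ⊢ₛ y) := by
  have := Derives.app (K := Set.univ) (H := H) (Asg.triple x y x) ha trivial
    (by simpa [cutRule, Seq.inst, Str.inst, Asg.triple] using And.intro h₁ h₂)
  simpa [cutRule, Seq.inst, Str.inst, Asg.triple] using this

/-- This is `RightIntro.cut` with `D` taken to be derivability from the premises of both
applications with cuts on proper subterms; `cutAdmissible_of_properSubterm` reuses that lemma with
cut-free derivability. -/
theorem principal_eliminable : (dynamicCalculus P F A classical).C8' := by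
  intro r₁ hr₁ r₂ hr₂ σ₁ σ₂ T a x y ha₁ ha₂ e₁ e₂
  refine ((mem_rules_iff.1 hr₁).rightIntro ha₁ e₁).cut
    (D := Derives _ Set.univ _) (fun s h => h.derives (classical := classical) Set.subset_union_left)
    (fun s t h => Derives.disp_iff (classical := classical) Set.subset_union_left h)
    ((mem_rules_iff.1 hr₂).leftIntro ha₂ e₂) (fun S b x y hb h₁ h₂ => ?_) ?_ ?_
  · exact .cut (Or.inr ⟨S, b, hb, rfl⟩) h₁ h₂
  · intro q hq
    obtain ⟨q', h, rfl⟩ := List.mem_map.1 hq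
    exact .hyp (Or.inl ⟨q', h, rfl⟩) trivial
  · intro q hq
    obtain ⟨q', h, rfl⟩ := List.mem_map.1 hq
    exact .hyp (Or.inr ⟨q', h, rfl⟩) trivial

end Principal

/-! ### Cut elimination by tracing the cut term, and its consequences. -/

section CutElimination

variable {P F A : Type u} {classical : Prop}

/-- `Rep a z κ b x x'`: for `x` in precedent (`b = true`) or succedent (`b = false`) position, `x'`
results from `x` by replacing with `z` some occurrences of the operational term `a` in the position
given by `κ`, none of them in the scope of a severe connective. -/
inductive Rep {S : Ty} (a : Term P F A S) (z : Str (Term P F A) S) (κ : Bool) :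
    Bool → {T : Ty} → Str (Term P F A) T → Str (Term P F A) T → Prop
  | refl (b : Bool) {T : Ty} (x : Str (Term P F A) T) : Rep a z κ b x x
  | here : Rep a z κ κ (.leaf a) z
  | node {b : Bool} {T₁ T₂ T : Ty} (c : Conn T₁ T₂ T) {x x' : Str (Term P F A) T₁}
      {y y' : Str (Term P F A) T₂} : ¬ c.Severe b → Rep a z κ (xor b c.neg₁) x x' →
      Rep a z κ (xor b c.neg₂) y y' → Rep a z κ b (.node c x y) (.node c x' y')

variable {S : Ty} {a : Term P F A S} {z : Str (Term P F A) S} {κ : Bool}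

/-- Agents and functional actions in precedent position have only severe connectives. -/
theorem Rep.eq_of_action (hS : ¬ (S = .ag ∨ S = .fnc)) {T : Ty} (hT : T = .ag ∨ T = .fnc)
    {x x' : Str (Term P F A) T} (h : Rep a z κ true x x') : x' = x := by
  cases h with
  | refl => rfl
  | here => exact (hS hT).elim
  | node c hc _ _ =>
    exfalso
    -- The connectives with value `ag` or `fnc` are all of the form `arr` or `lar`, which are severe
    -- in precedent position.
    cases c with
    | arr s i => exact hc rfl
    | lar s i => exact hc rfl
    | tri s i => rcases hT with rfl | rfl <;> cases i
    | _ => rcases hT with hT | hT <;> cases hT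

theorem Str.inst_congr {σ σ' : Asg P F A} {T : Ty} (x : Str (Sch P F A) T) (b : Bool)
    (h : ∀ R n b', (R, n, b') ∈ x.occs b → σ R n = σ' R n) : x.inst σ = x.inst σ' := by
  induction x generalizing b with
  | leaf c =>
    cases c with
    | var n => exact h _ n b (by simp [Str.occs])
    | term c => rfl
  | unit => rfl
  | node c x y ihx ihy =>
    simp only [Str.inst]
    rw [ihx _ fun R n b' hn => h R n b' (List.mem_append_left _ hn),
      ihy _ fun R n b' hn => h R n b' (List.mem_append_right _ hn)]

/-- The assignment `σ'` results from `σ` by replacements, at the given variable occurrences. -/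
def RepOn (a : Term P F A S) (z : Str (Term P F A) S) (κ : Bool) (l : List (Ty × ℕ × Bool))
    (σ σ' : Asg P F A) : Prop :=
  ∀ R n b, (R, n, b) ∈ l → Rep a z κ b (σ R n) (σ' R n)

/-- A variable common to both lists has type `ag` or `fnc` and precedent position, where replacement
does nothing. Hence `σ₁` and `σ₂` both agree with `σ` on it and can be glued. -/
theorem RepOn.merge (hS : ¬ (S = .ag ∨ S = .fnc)) {l₁ l₂ : List (Ty × ℕ × Bool)}
    (hl : ∀ o ∈ l₁, ∀ o' ∈ l₂, Compat o o') {σ σ₁ σ₂ : Asg P F A} (h₁ : RepOn a z κ l₁ σ σ₁)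
    (h₂ : RepOn a z κ l₂ σ σ₂) :
    ∃ σ' : Asg P F A, (∀ R n b, (R, n, b) ∈ l₁ → σ₁ R n = σ' R n) ∧
      (∀ R n b, (R, n, b) ∈ l₂ → σ₂ R n = σ' R n) ∧ RepOn a z κ (l₁ ++ l₂) σ σ' := by
  classical
  have key : ∃ σ' : Asg P F A, (∀ R n b, (R, n, b) ∈ l₁ → σ₁ R n = σ' R n) ∧
      (∀ R n b, (R, n, b) ∈ l₂ → σ₂ R n = σ' R n) := by
    refine ⟨fun R n => if ∃ b, (R, n, b) ∈ l₁ then σ₁ R n else σ₂ R n, fun R n b h => ?_,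
      fun R n b h => ?_⟩
    · dsimp only
      rw [if_pos ⟨b, h⟩]
    · dsimp only
      by_cases h' : ∃ b, (R, n, b) ∈ l₁
      · rw [if_pos h']
        obtain ⟨b', h'⟩ := h'
        obtain ⟨hR, hb', hb⟩ := hl _ h' _ h rfl rfl
        dsimp only at hR hb hb'
        subst hb hb'
        rw [(h₁ _ _ _ h').eq_of_action hS hR, (h₂ _ _ _ h).eq_of_action hS hR]
      · rw [if_neg h']
  obtain ⟨σ', e₁, e₂⟩ := key
  refine ⟨σ', e₁, e₂, fun R n b h => ?_⟩
  rcases List.mem_append.1 h with h | h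
  · rw [← e₁ _ _ _ h]
    exact h₁ _ _ _ h
  · rw [← e₂ _ _ _ h]
    exact h₂ _ _ _ h

/-- Without severe connectives in the schema, occurrences outside severe scopes in the parameters
stay so in the instance. This carries replacements from a conclusion to the premises. -/
theorem Rep.inst {σ σ' : Asg P F A} {T : Ty} (x : Str (Sch P F A) T) (b : Bool)
    (hx : x.NoSevere b) (h : RepOn a z κ (x.occs b) σ σ') :
    Rep a z κ b (x.inst σ) (x.inst σ') := by
  induction x generalizing b with
  | leaf c =>
    cases c with
    | var n => exact h _ n b (by simp [Str.occs])
    | term c => exact .refl _ _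
  | unit => exact .refl _ _
  | node c x y ihx ihy =>
    exact .node c hx.1 (ihx _ hx.2.1 fun R n b' hn => h R n b' (List.mem_append_left _ hn))
      (ihy _ hx.2.2 fun R n b' hn => h R n b' (List.mem_append_right _ hn))

/-- Replacements in an instance of a schema without operational terms come from replacements in
the assignment. -/
theorem Rep.exists_inst (hS : ¬ (S = .ag ∨ S = .fnc)) {σ : Asg P F A} {T : Ty}
    (x : Str (Sch P F A) T) (b : Bool) (hx : x.terms = []) (hc : (x.occs b).Pairwise Compat)
    {x' : Str (Term P F A) T} (h : Rep a z κ b (x.inst σ) x') :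
    ∃ σ' : Asg P F A, x' = x.inst σ' ∧ RepOn a z κ (x.occs b) σ σ' := by
  induction x generalizing b with
  | leaf c =>
    cases c with
    | var n =>
      -- Only the value at this one variable matters, so a constant assignment will do.
      refine ⟨fun R _ => x'.castTo R, by simp [Str.inst], fun R m b' hm => ?_⟩
      simp only [Str.occs, List.mem_singleton, Prod.mk.injEq] at hm
      obtain ⟨rfl, rfl, rfl⟩ := hm
      simpa [Str.inst] using h
    | term c => simp [Str.terms] at hx
  | unit => exact ⟨σ, by cases h; rfl, fun _ _ _ _ => .refl _ _⟩
  | node c x y ihx ihy =>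
    obtain ⟨hc₁, hc₂, hc₃⟩ := List.pairwise_append.1 hc
    obtain ⟨hx₁, hx₂⟩ := List.append_eq_nil_iff.1 hx
    cases h with
    | refl => exact ⟨σ, rfl, fun _ _ _ _ => .refl _ _⟩
    | node _ _ h₁ h₂ =>
      obtain ⟨σ₁, rfl, k₁⟩ := ihx _ hx₁ hc₁ h₁
      obtain ⟨σ₂, rfl, k₂⟩ := ihy _ hx₂ hc₂ h₂
      obtain ⟨σ', e₁, e₂, h⟩ := RepOn.merge hS hc₃ k₁ k₂
      refine ⟨σ', ?_, h⟩
      rw [Str.inst, x.inst_congr _ e₁, y.inst_congr _ e₂]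

/-- A side that displays an operational term consists of it alone, so a replacement is either purely
parametric or hits the principal term itself. -/
theorem Rep.exists_inst_of_topTerms (hS : ¬ (S = .ag ∨ S = .fnc)) {σ : Asg P F A} {T : Ty}
    (x : Str (Sch P F A) T) (b : Bool) (hx : x.TopTerms) (hc : (x.occs b).Pairwise Compat)
    {x' : Str (Term P F A) T} (h : Rep a z κ b (x.inst σ) x') :
    (∃ σ' : Asg P F A, x' = x.inst σ' ∧ RepOn a z κ (x.occs b) σ σ') ∨
      (b = κ ∧ ∃ e : S = T, x = .leaf (.term (e ▸ a)) ∧ x' = e ▸ z) := by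
  rcases hx with hx | ⟨c, rfl⟩
  · exact Or.inl (h.exists_inst hS x b hx hc)
  · cases h with
    | refl => exact Or.inl ⟨σ, rfl, fun _ _ _ _ => .refl _ _⟩
    | here => exact Or.inr ⟨rfl, rfl, rfl, rfl⟩

/-- The functional actions in the chain are unaffected by `eq_of_action`, so only the atom at its
end can change. -/
theorem PreChain.rep (hS : ¬ (S = .ag ∨ S = .fnc)) {p : P} {x x' : Str (Term P F A) .fm}
    (hx : PreChain (.leaf (.prop p)) x) (h : Rep a z κ true x x') :
    x' = x ∨ (κ = true ∧ ∃ e : S = .fm, e ▸ a = .prop p ∧ PreChain (e ▸ z) x') := by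
  induction hx generalizing x' with
  | base =>
    cases h with
    | refl => exact Or.inl rfl
    | here => exact Or.inr ⟨rfl, rfl, rfl, .base⟩
  | step s f _ ih =>
    cases h with
    | refl => exact Or.inl rfl
    | node _ _ h₁ h₂ =>
      rw [h₁.eq_of_action hS (Or.inr rfl)]
      rcases ih h₂ with rfl | ⟨h, e, ha, h'⟩
      · exact Or.inl rfl
      · exact Or.inr ⟨h, e, ha, .step _ _ h'⟩

theorem SucChain.rep (hS : ¬ (S = .ag ∨ S = .fnc)) {p : P} {x x' : Str (Term P F A) .fm}
    (hx : SucChain (.leaf (.prop p)) x) (h : Rep a z κ false x x') :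
    x' = x ∨ (κ = false ∧ ∃ e : S = .fm, e ▸ a = .prop p ∧ SucChain (e ▸ z) x') := by
  induction hx generalizing x' with
  | base =>
    cases h with
    | refl => exact Or.inl rfl
    | here => exact Or.inr ⟨rfl, rfl, rfl, .base⟩
  | step s f _ ih =>
    cases h with
    | refl => exact Or.inl rfl
    | node _ _ h₁ h₂ =>
      rw [h₁.eq_of_action hS (Or.inr rfl)]
      rcases ih h₂ with rfl | ⟨h, e, ha, h'⟩
      · exact Or.inl rfl
      · exact Or.inr ⟨h, e, ha, .step _ _ h'⟩

/-- Cuts of `z` against applications of rules with principal term `a` in position `κ` are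
admissible. -/
structure PrincipalCut (classical : Prop) (a : Term P F A S) (z : Str (Term P F A) S)
    (κ : Bool) : Prop where
  left : κ = true → ∀ l y, LeftIntro l a y →
    (∀ q ∈ l, (dynamicCalculus P F A classical).CutFreeDerivable q) →
    (dynamicCalculus P F A classical).CutFreeDerivable (z ⊢ₛ y)
  right : κ = false → ∀ l x, RightIntro l x a →
    (∀ q ∈ l, (dynamicCalculus P F A classical).CutFreeDerivable q) →
    (dynamicCalculus P F A classical).CutFreeDerivable (x ⊢ₛ z)

theorem AxInst.rep (hS : ¬ (S = .ag ∨ S = .fnc)) (H : PrincipalCut classical a z κ)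
    {s : Seq (Term P F A)} (h : AxInst s) {x : Str (Term P F A) s.lt} {y : Str (Term P F A) s.rt}
    (hx : Rep a z κ true s.l x) (hy : Rep a z κ false s.r y) :
    (dynamicCalculus P F A classical).CutFreeDerivable (x ⊢ₛ y) := by
  cases h with
  | agt a =>
    rw [hx.eq_of_action hS (Or.inl rfl)]
    cases hy with
    | refl => exact (AxInst.agt a).derives subset_rfl
    | here => exact (hS (Or.inl rfl)).elim
  | fnc a =>
    rw [hx.eq_of_action hS (Or.inr rfl)]
    cases hy with
    | refl => exact (AxInst.fnc a).derives subset_rfl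
    | here => exact (hS (Or.inr rfl)).elim
  | bot =>
    cases hy
    cases hx with
    | refl => exact AxInst.bot.derives subset_rfl
    | here => exact H.left rfl _ _ .bot (by simp)
  | top =>
    cases hx
    cases hy with
    | refl => exact AxInst.top.derives subset_rfl
    | here => exact H.right rfl _ _ .top (by simp)
  | atom p hx₀ hy₀ =>
    rcases hx₀.rep hS hx with hx' | ⟨hκ, e, ha, hx'⟩
    · rw [hx']
      rcases hy₀.rep hS hy with hy' | ⟨hκ, e, ha, hy'⟩
      · rw [hy']
        exact (AxInst.atom p hx₀ hy₀).derives subset_rfl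
      · subst e
        cases ha
        -- The structure replacing the atom is displayed, obtained there by a principal cut against
        -- another atom axiom, and the links are moved back.
        obtain ⟨x', h₁, h₂⟩ := hy'.displayEquiv (classical := classical) hx₀
        exact (H.right hκ _ _ (.prop p h₁) (by simp)).of_displayEquiv subset_rfl h₂.symm
    · rcases hy₀.rep hS hy with hy' | ⟨hκ', -⟩
      · rw [hy']
        subst e
        cases ha
        obtain ⟨y', h₁, h₂⟩ := hx'.displayEquiv (classical := classical) hy₀
        exact (H.left hκ _ _ (.prop p h₁) (by simp)).of_displayEquiv subset_rfl h₂.symm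
      · simp [hκ] at hκ'

theorem typeUniform_of_cutFreeDerivable {s : Seq (Term P F A)}
    (h : (dynamicCalculus P F A classical).CutFreeDerivable s) : s.lt = s.rt :=
  Derives.typeUniform (fun _ hr => (mem_rules_iff.1 hr).regular) h

/-- The parametric step of cut elimination. -/
theorem PrincipalCut.rep (hS : ¬ (S = .ag ∨ S = .fnc)) (H : PrincipalCut classical a z κ)
    {s : Seq (Term P F A)} (h : (dynamicCalculus P F A classical).CutFreeDerivable s) :
    ∀ (x : Str (Term P F A) s.lt) (y : Str (Term P F A) s.rt), Rep a z κ true s.l x →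
      Rep a z κ false s.r y → (dynamicCalculus P F A classical).CutFreeDerivable (x ⊢ₛ y) := by
  unfold Calculus.CutFreeDerivable at h
  induction h with
  | hyp h => exact h.elim
  | @app r σ hr _ _ ih =>
    intro x y hx hy
    have hk := mem_rules_iff.1 hr
    have hreg := hk.regular
    -- Replacements in the parameters of the conclusion carry over to every premise, because premise
    -- variables recur in the conclusion in the same position; the induction hypothesis then
    -- applies.
    have prem : ∀ σ', RepOn a z κ r.concl.occs σ σ' → ∀ q ∈ r.prems,
        (dynamicCalculus P F A classical).CutFreeDerivable (q.inst σ') := by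
      intro σ' h q hq
      have h' : RepOn a z κ q.occs σ σ' := fun R n b hn => h R n b (hreg.occs_prem q hq hn)
      exact ih q hq _ _
        (.inst _ _ (hreg.noSevere q hq).1 fun R n b hn => h' R n b (List.mem_append_left _ hn))
        (.inst _ _ (hreg.noSevere q hq).2 fun R n b hn => h' R n b (List.mem_append_right _ hn))
    have concl : ∀ σ', RepOn a z κ r.concl.occs σ σ' →
        (dynamicCalculus P F A classical).CutFreeDerivable (r.concl.inst σ') :=
      fun σ' h => .app σ' hr trivial (prem σ' h)
    rcases hreg.topTerms with hp | ⟨ht₁, ht₂⟩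
    · exact ((hk.ax_of_prems_eq_nil hp).axInst σ).rep hS H hx hy
    obtain ⟨hc₁, hc₂, hc₃⟩ := List.pairwise_append.1 hreg.compat
    obtain ⟨prems, @⟨T, U, l, t⟩⟩ := r
    rcases hx.exists_inst_of_topTerms hS l true ht₁ hc₁ with ⟨σ₁, rfl, h₁⟩ | ⟨hκ, e, h₁, rfl⟩
    · rcases hy.exists_inst_of_topTerms hS t false ht₂ hc₂ with ⟨σ₂, rfl, h₂⟩ | ⟨hκ, e, h₂, rfl⟩
      · obtain ⟨σ', e₁, e₂, h⟩ := RepOn.merge hS hc₃ h₁ h₂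
        have := concl σ' h
        rwa [Seq.inst, ← l.inst_congr _ e₁, ← t.inst_congr _ e₂] at this
      -- The principal term is itself to be replaced: the rule application with its parameters
      -- already replaced is used for a principal cut.
      · subst e h₂
        have h : RepOn a z κ (Seq.occs ⟨l, .leaf (.term a)⟩) σ σ₁ := by
          simpa [Seq.occs, Str.occs] using h₁
        -- `RightIntro` needs both sides to have one type, which is read off from the derivable
        -- modified conclusion.
        cases (typeUniform_of_cutFreeDerivable (concl σ₁ h) : T = S)
        refine H.right hκ.symm _ _ (hk.rightIntro (σ := σ₁) rfl rfl) fun q hq => ?_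
        obtain ⟨q', hq', rfl⟩ := List.mem_map.1 hq
        exact prem σ₁ h q' hq'
    · rcases hy.exists_inst_of_topTerms hS t false ht₂ hc₂ with ⟨σ₂, rfl, h₂⟩ | ⟨hκ', -⟩
      · subst e h₁
        have h : RepOn a z κ (Seq.occs ⟨.leaf (.term a), t⟩) σ σ₂ := by
          simpa [Seq.occs, Str.occs] using h₂
        cases (typeUniform_of_cutFreeDerivable (concl σ₂ h) : S = U)
        refine H.left hκ.symm _ _ (hk.leftIntro (σ := σ₂) rfl rfl) fun q hq => ?_
        obtain ⟨q', hq', rfl⟩ := List.mem_map.1 hq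
        exact prem σ₂ h q' hq'
      -- Both sides cannot be replaced at once, since `κ` fixes a single position.
      · cases hκ.trans hκ'.symm

/-- Cuts with cut term `a` are admissible in the calculus without cut. -/
def CutAdmissible (classical : Prop) {T : Ty} (a : Term P F A T) : Prop :=
  ∀ x y : Str (Term P F A) T,
    (dynamicCalculus P F A classical).CutFreeDerivable (x ⊢ₛ .leaf a) →
    (dynamicCalculus P F A classical).CutFreeDerivable (.leaf a ⊢ₛ y) →
    (dynamicCalculus P F A classical).CutFreeDerivable (x ⊢ₛ y)

theorem Derives.mono {R R' : Set (Rule P F A)} {K K' H : Set (Seq (Term P F A))} (hR : R ⊆ R')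
    (hK : K ⊆ K') {s : Seq (Term P F A)} (h : Derives R K H s) : Derives R' K' H s := by
  induction h with
  | hyp h h' => exact .hyp h (hK h')
  | app σ hr hk _ ih => exact .app σ (hR hr) (hK hk) ih

theorem cutAdmissible_of_properSubterm (a : Term P F A S)
    (ih : ∀ (T : Ty) (b : Term P F A T), ProperSubterm b a → CutAdmissible classical b) :
    CutAdmissible classical a := by
  intro x y hx hy
  by_cases hS : S = .ag ∨ S = .fnc
  · rwa [eq_leaf_of_derivable hS (Derives.mono Set.subset_union_left subset_rfl hx)]
  -- With `a` principal on the right of the cut, the derivation of `x ⊢ a` is traced and `a` in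
  -- succedent position replaced by `w`.
  · have key : ∀ l w, LeftIntro l a w →
        (∀ q ∈ l, (dynamicCalculus P F A classical).CutFreeDerivable q) →
        (dynamicCalculus P F A classical).CutFreeDerivable (x ⊢ₛ w) := by
      intro l w hl hq
      have H : PrincipalCut classical a w false := by
        refine ⟨fun h => (by cases h), fun _ m x' hr hm => ?_⟩
        exact hr.cut (D := (dynamicCalculus P F A classical).CutFreeDerivable)
          (fun s h => h.derives subset_rfl) (fun s t h => Derives.disp_iff subset_rfl h) hl
          (fun T b x y hb => ih T b hb x y) hm hq
      exact H.rep hS hx _ _ (.refl _ _) .here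
    -- In the general case the derivation of `a ⊢ y` is traced and `a` in precedent position
    -- replaced by `x`, with `key` at the principal occurrences.
    have H : PrincipalCut classical a x true := ⟨fun _ => key, fun h => by cases h⟩
    exact H.rep hS hy _ _ .here (.refl _ _)

theorem cutAdmissible (classical : Prop) {T : Ty} (a : Term P F A T) :
    CutAdmissible classical a := by
  -- Strengthened to all subterms, because a principal step needs every proper subterm and not only
  -- the two children.
  suffices ∀ (S : Ty) (b : Term P F A S), Subterm b a → CutAdmissible classical b from
    this T a (.refl a)
  induction a with
  | node c a₁ a₂ ih₁ ih₂ =>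
    intro S b hb
    cases hb with
    | refl =>
      refine cutAdmissible_of_properSubterm _ fun S b hb => ?_
      cases hb with
      | left _ _ h => exact ih₁ S b h
      | right _ _ h => exact ih₂ S b h
    | left _ _ h => exact ih₁ S b h
    | right _ _ h => exact ih₂ S b h
  | _ =>
    intro S b hb
    cases hb
    exact cutAdmissible_of_properSubterm _ fun S b hb => by cases hb

theorem cutElimination : CutElimination (dynamicCalculus P F A classical) := by
  intro s h
  unfold Calculus.Derivable at h
  induction h with
  | hyp h => exact h.elim
  | @app r σ hr _ _ ih =>
    rcases hr with hr | ⟨T, a, rfl⟩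
    · exact .app σ hr trivial ih
    · exact cutAdmissible classical a _ _ (ih ((v 0 : Str _ T) ⊢ₛ o a) (by simp [cutRule]))
        (ih (o a ⊢ₛ (v 1 : Str _ T)) (by simp [cutRule]))

theorem Subterm.trans {T U : Ty} {a : Term P F A S} {b : Term P F A T} {c : Term P F A U}
    (h : Subterm a b) (h' : Subterm b c) : Subterm a c := by
  induction h' with
  | refl => exact h
  | left c d _ ih => exact .left c d (ih h)
  | right c d _ ih => exact .right c d (ih h)

theorem preservesTerms : (dynamicCalculus P F A classical).C1 := fun _ hr =>
  Rule.subterm_of_hasTerm_prem (mem_rules_iff.1 hr).regular (mem_rules_iff.1 hr).termsPreserved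

/-- Along a cut-free derivation preservation of terms composes by transitivity of `Subterm`: the
bound for a premise is contained in the bound for the conclusion. -/
theorem subformulaProperty : SubformulaProperty (dynamicCalculus P F A classical) := by
  intro s hs
  have h := cutElimination s hs
  unfold Calculus.CutFreeDerivable at h
  clear hs
  induction h with
  | hyp h => exact h.elim
  | @app r σ hr _ _ ih =>
    refine .app σ hr (fun T a ha => ⟨T, a, ha, .refl a⟩) fun q hq => ?_
    refine Derives.mono subset_rfl ?_ (ih q hq)
    intro t ht T a ha
    obtain ⟨U, b, hb, hab⟩ := ht T a ha
    obtain ⟨V, c, hc, hbc⟩ := preservesTerms r hr σ q hq U b hb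
    exact ⟨V, c, hc, hab.trans hbc⟩

theorem derivable_typeUniform : (dynamicCalculus P F A classical).C9 := fun _ h =>
  ⟨_, rfl, (typeUniform_of_derivable h).symm⟩

theorem quasiProperlyDisplayable :
    QuasiProperlyDisplayable (dynamicCalculus P F A classical) where
  displayProperty := displayProperty
  c1 := preservesTerms
  c2 _ _ _ _ _ h := h.exists_val
  c2' _ _ _ _ _ h _ _ hz hz' := by
    obtain ⟨w, h₁, h₂⟩ := h.exists_val
    rw [h₁] at hz
    rw [h₂] at hz'
    rw [← Option.some.inj hz, ← Option.some.inj hz']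
  c3' _ hr _ T _ _ _ _ h h' hi hi' := by
    by_cases hT : T = .ag ∨ T = .fnc
    · exact Or.inr (trivialCuts hT)
    · exact Or.inl ((regular_of_mem_allRules hr).eq_of_isParam h h' hi hi' hT)
  c4 _ hr _ _ _ h := (regular_of_mem_allRules hr).ant_eq h
  c5' _ hr _ a d p h := (regular_of_mem_allRules hr).principal a d p h
  c5'' := axioms_displayInvariant
  c6' := Calculus.substClosed _ _
  c7' := Calculus.substClosed _ _
  c8' := principal_eliminable
  c8'' := axioms_closed_cut
  c9 := derivable_typeUniform
  c10 := by
    rintro _ ⟨T, a, rfl⟩ σ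
    exact ⟨T, ⟨rfl, rfl⟩, by simp [cutRule, Seq.OfType, Seq.inst]⟩

end CutElimination

end DynCalc

theorem mainTheorem4 (AtProp Fnc Ag : Type u) (classical : Prop) :
    DynCalc.QuasiProperlyDisplayable (DynCalc.dynamicCalculus AtProp Fnc Ag classical) ∧
    (∀ s, (DynCalc.dynamicCalculus AtProp Fnc Ag classical).Derivable s → s.TypeUniform) ∧
    (∀ (T : DynCalc.Ty) (x : DynCalc.Str (DynCalc.Term AtProp Fnc Ag) T)
      (a : DynCalc.Term AtProp Fnc Ag T), (T = .ag ∨ T = .fnc) →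
      (DynCalc.dynamicCalculus AtProp Fnc Ag classical).Derivable ⟨x, .leaf a⟩ → x = .leaf a) ∧
    DynCalc.CutElimination (DynCalc.dynamicCalculus AtProp Fnc Ag classical) ∧
    DynCalc.SubformulaProperty (DynCalc.dynamicCalculus AtProp Fnc Ag classical) :=
  ⟨DynCalc.quasiProperlyDisplayable, DynCalc.derivable_typeUniform,
    fun _ _ _ hT h => DynCalc.eq_leaf_of_derivable hT h, DynCalc.cutElimination,
    DynCalc.subformulaProperty⟩
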